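/- Work over $\mathbf{C}$. Let $n\ge 2$ and let $k\ge d\ge 1$ be integers. Let $Z\subset\mathbf{P}^n$ be a smooth complete intersection of type $(k,k-d)$, with the convention $Z=\emptyset$ if $k=d$. Let $W^b$ be a general member of the class of degree $2k$ hypersurfaces in $\mathbf{P}^n$ with an ordinary double singularity along $Z$ (that is, $W^b$ is singular at every point of $Z$, and at the general point of $Z$ its tangent cone is a pair of distinct hyperplanes). Then there exists an algebraic family, of dimension at least $h^0(\mathbf{P}^n,\mathcal{O}(2d-k))$, of smooth degree $2d$ hypersurfaces $B\subset\mathbf{P}^n$ such that each member $B$ of the family has the following properties: (i) $B$ has no common component with $W^b$ and is everywhere tangent to $W^b$, i.e. $T_xB\subseteq T_xW^b$ for every $x\in B\cap W^b$; (ii) there exists a unique degree $k$ hypersurface $A$ containing $Z$ and cutting out on $B$ the contact locus of $B$ and $W^b$, i.e. such that $W^b|_B=2A|_B$ as divisors on $B$; (iii) $W^b$ lifts to the double cover $\pi:V\to\mathbf{P}^n$ branched over $B$: if $i$ is the covering involution and $L=\pi^*\mathcal{O}(1)$, there is a divisor $W\in|kL|$ such that $\pi^*W^b=W+i(W)$ and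 such that $\pi|_W:W\to W^b$ is one-to-one over $W^b\setminus Z$. -/

import Mathlib

open MvPolynomial

noncomputable section

/-- The complex projective space `P^n`, as a set of points. -/
abbrev ProjSpace (n : ℕ) : Type := Projectivization ℂ (Fin (n + 1) → ℂ)

/-- Degree `e` hypersurfaces in `P^n` (effective divisors of degree `e`): nonzero homogeneous forms
of degree `e` up to scalars, i.e. the points of the projective space `|O(e)|`. -/
abbrev ProjHypersurface (n e : ℕ) : Type :=
  Projectivization ℂ (homogeneousSubmodule (Fin (n + 1)) ℂ e)

/-- `h^0(P^n, O(e))`: the dimension of the space of forms of degree `e`, zero if `e < 0`. -/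
def hZero (n : ℕ) (e : ℤ) : ℕ :=
  if 0 ≤ e then Module.finrank ℂ (homogeneousSubmodule (Fin (n + 1)) ℂ e.toNat) else 0

/-- The gradient of a form at a vector. -/
def gradAt {n : ℕ} (p : MvPolynomial (Fin (n + 1)) ℂ) (x : Fin (n + 1) → ℂ) : Fin (n + 1) → ℂ :=
  fun i => eval x (pderiv i p)

/-- The Hessian matrix of a form at a vector. -/
def hessianAt {n : ℕ} (p : MvPolynomial (Fin (n + 1)) ℂ) (x : Fin (n + 1) → ℂ) :
    Matrix (Fin (n + 1)) (Fin (n + 1)) ℂ :=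
  Matrix.of fun i j => eval x (pderiv i (pderiv j p))

namespace ProjHypersurface

/-- An equation of a hypersurface (well defined up to a nonzero scalar). -/
def eqn {n e : ℕ} (G : ProjHypersurface n e) : MvPolynomial (Fin (n + 1)) ℂ :=
  (G.rep : homogeneousSubmodule (Fin (n + 1)) ℂ e)

/-- The points of a hypersurface. -/
def points {n e : ℕ} (G : ProjHypersurface n e) : Set (ProjSpace n) :=
  {x | eval x.rep G.eqn = 0}

/-- Smoothness, by the Jacobian criterion. -/
def IsSmooth {n e : ℕ} (G : ProjHypersurface n e) : Prop :=
  ∀ x ∈ G.points, gradAt G.eqn x.rep ≠ 0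

end ProjHypersurface

/-- `Z` is a smooth complete intersection of type `(a, b)` in `P^n`: the common zero locus of two
forms of degrees `a` and `b` whose differentials are linearly independent at each point of `Z`
(so that the scheme defined by the two forms is smooth of codimension two, and is determined by its
set of points). If `n ≥ 2`, `a ≥ 1` and `b = 0`, this says that `Z` is empty. -/
def IsSmoothCompleteIntersection (n a b : ℕ) (Z : Set (ProjSpace n)) : Prop :=
  ∃ f h : MvPolynomial (Fin (n + 1)) ℂ, f.IsHomogeneous a ∧ h.IsHomogeneous b ∧
    Z = {x | eval x.rep f = 0 ∧ eval x.rep h = 0} ∧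
    ∀ x ∈ Z, LinearIndependent ℂ ![gradAt f x.rep, gradAt h x.rep]

/-- `W` is singular (of multiplicity at least two) at `x`. -/
def IsSingularAt {n e : ℕ} (W : ProjHypersurface n e) (x : ProjSpace n) : Prop :=
  x ∈ W.points ∧ gradAt W.eqn x.rep = 0

/-- `W` has at `x` a double point whose tangent cone is a pair of distinct hyperplanes, i.e. a
quadric of rank two. -/
def IsOrdinaryDoubleAt {n e : ℕ} (W : ProjHypersurface n e) (x : ProjSpace n) : Prop :=
  IsSingularAt W x ∧ (hessianAt W.eqn x.rep).rank = 2

/-- `W` has an ordinary double singularity along `Z` (of codimension two): `W` is singular at every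
point of `Z`, and at the general point of `Z` (on a Zariski dense subset of `Z`) its tangent cone
consists of two distinct hyperplanes. At special points of `Z` the two hyperplanes may come
together (pinch points); if `Z` is finite there is no such special point. -/
def HasOrdinaryDoubleSingularityAlong {n e : ℕ} (W : ProjHypersurface n e)
    (Z : Set (ProjSpace n)) : Prop :=
  (∀ x ∈ Z, IsSingularAt W x) ∧
  ∀ (m : ℕ) (q : MvPolynomial (Fin (n + 1)) ℂ), q.IsHomogeneous m →
    (∃ x ∈ Z, eval x.rep q ≠ 0) → ∃ x ∈ Z, eval x.rep q ≠ 0 ∧ IsOrdinaryDoubleAt W x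

/-- Zariski open subsets of the projective space of degree `e` hypersurfaces: unions of
non-vanishing loci of homogeneous polynomials in the coefficients of the equation. -/
def IsZariskiOpen {n e : ℕ} (U : Set (ProjHypersurface n e)) : Prop :=
  ∃ S : Set (MvPolynomial (Fin (n + 1) →₀ ℕ) ℂ), (∀ Φ ∈ S, ∃ m, Φ.IsHomogeneous m) ∧
    U = {G | ∃ Φ ∈ S, eval (fun μ => coeff μ G.eqn) Φ ≠ 0}

/-- `P` holds for the general member of the class `S` of hypersurfaces: it holds on `S ∩ U`, for
some Zariski open `U` such that `S ∩ U` is dense in `S`. -/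
def HoldsForGeneral {n e : ℕ} (S : Set (ProjHypersurface n e))
    (P : ProjHypersurface n e → Prop) : Prop :=
  ∃ U : Set (ProjHypersurface n e), IsZariskiOpen U ∧
    (∀ U' : Set (ProjHypersurface n e), IsZariskiOpen U' → (S ∩ U').Nonempty →
      (S ∩ U ∩ U').Nonempty) ∧
    ∀ G ∈ S ∩ U, P G

/-- `T` is a locally closed subset of affine space: a closed set minus a closed set. -/
def IsZariskiLocallyClosed {r : ℕ} (T : Set (Fin r → ℂ)) : Prop :=
  ∃ I J : Ideal (MvPolynomial (Fin r) ℂ), T = zeroLocus ℂ I \ zeroLocus ℂ J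

/-- The set `S` of hypersurfaces contains an algebraic family of dimension at least `N`: there are
an irreducible locally closed `T` in some affine space, of dimension at least `N` (the Krull
dimension of the coordinate ring of its closure), and a form `F` of degree `e` whose coefficients
are polynomial functions of `t`, such that each `F_t`, `t ∈ T`, is the equation of a member of `S`,
and each hypersurface occurs for finitely many `t ∈ T` only. -/
def ContainsFamilyOfDim {n e : ℕ} (S : Set (ProjHypersurface n e)) (N : ℕ) : Prop :=
  ∃ (r : ℕ) (T : Set (Fin r → ℂ)) (F : MvPolynomial (Fin (n + 1)) (MvPolynomial (Fin r) ℂ)),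
    IsZariskiLocallyClosed T ∧
    (vanishingIdeal ℂ T).IsPrime ∧
    (N : WithBot ℕ∞) ≤ ringKrullDim (MvPolynomial (Fin r) ℂ ⧸ vanishingIdeal ℂ T) ∧
    F.IsHomogeneous e ∧
    (∀ t ∈ T, ∃ G ∈ S, ∃ c : ℂ, c ≠ 0 ∧ MvPolynomial.map (eval t) F = c • G.eqn) ∧
    ∀ G : ProjHypersurface n e,
      {t ∈ T | ∃ c : ℂ, c ≠ 0 ∧ MvPolynomial.map (eval t) F = c • G.eqn}.Finite

/-- `B` is everywhere tangent to `W`: they have no common component, and at every common point `x`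
the tangent space of `B` is contained in that of `W`. -/
def IsEverywhereTangent {n b w : ℕ} (B : ProjHypersurface n b) (W : ProjHypersurface n w) : Prop :=
  IsRelPrime B.eqn W.eqn ∧
  ∀ x ∈ B.points ∩ W.points, ∀ v : Fin (n + 1) → ℂ,
    gradAt B.eqn x.rep ⬝ᵥ v = 0 → gradAt W.eqn x.rep ⬝ᵥ v = 0

/-- `A` cuts out on `B` the contact locus of `B` and `W`: the divisor cut out by `W` on `B` is twice
the divisor cut out by `A`, that is, the subschemes `B ∩ W` and `B ∩ 2A` of `P^n` coincide. (For
`n ≥ 2` the homogeneous ideals of complete intersections of two hypersurfaces are saturated, so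
equality of subschemes is equality of these ideals.) -/
def CutsOutContactLocus {n a b w : ℕ} (A : ProjHypersurface n a) (B : ProjHypersurface n b)
    (W : ProjHypersurface n w) : Prop :=
  Ideal.span {B.eqn, W.eqn} = Ideal.span {B.eqn, A.eqn ^ 2}

/-- The homogeneous coordinate ring `ℂ[x_0, …, x_n, y] / (y ^ 2 - b(x))` of the double cover
`π : V → P^n` branched over `B : b = 0`, where `V` is the hypersurface `y ^ 2 = b(x)` in the
weighted projective space `P(1^{n+1}, d)`. -/
abbrev DoubleCoverRing {n d : ℕ} (B : ProjHypersurface n (2 * d)) : Type :=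
  AdjoinRoot ((Polynomial.X : Polynomial (MvPolynomial (Fin (n + 1)) ℂ)) ^ 2 - Polynomial.C B.eqn)

/-- The pull-back `π^*` of forms to the double cover. -/
abbrev doubleCoverPullback {n d : ℕ} (B : ProjHypersurface n (2 * d)) :
    MvPolynomial (Fin (n + 1)) ℂ →+* DoubleCoverRing B :=
  AdjoinRoot.of _

/-- The covering involution `(x, y) ↦ (x, -y)`, on coordinate rings. -/
def coverInvolution {n d : ℕ} (B : ProjHypersurface n (2 * d)) :
    DoubleCoverRing B →+* DoubleCoverRing B :=
  AdjoinRoot.lift (doubleCoverPullback B) (-AdjoinRoot.root _) (by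
    have h := AdjoinRoot.eval₂_root
      ((Polynomial.X : Polynomial (MvPolynomial (Fin (n + 1)) ℂ)) ^ 2 - Polynomial.C B.eqn)
    simpa using h)

/-- The degree `2k` hypersurface `W`, double along `Z`, lifts to the double cover `π : V → P^n`
branched over `B`, where `L = π^* O(1)`: there is a divisor `W'` in `|kL|` on `V`, given by a section
`u + y v` with `u`, `v` forms of degrees `k`, `k - d`, such that `π^* W = W' + i(W')` with `i` the
covering involution, and such that `W' → W` is one-to-one outside `Z` (over `x ∈ W`, the points of
`V` are the `(x, y)` with `y ^ 2 = b(x)`), so that `W'` is not invariant under `i`. -/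
def LiftsToDoubleCover {n d k : ℕ} (W : ProjHypersurface n (2 * k)) (Z : Set (ProjSpace n))
    (B : ProjHypersurface n (2 * d)) : Prop :=
  ∃ u v : MvPolynomial (Fin (n + 1)) ℂ,
    u.IsHomogeneous k ∧ v.IsHomogeneous (k - d) ∧ (k < d → v = 0) ∧
    (∃ s : DoubleCoverRing B,
      s = doubleCoverPullback B u + AdjoinRoot.root _ * doubleCoverPullback B v ∧
      ∃ c : ℂ, c ≠ 0 ∧
        doubleCoverPullback B W.eqn = doubleCoverPullback B (C c) * (s * coverInvolution B s)) ∧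
    ∀ x ∈ W.points \ Z,
      ∃! y : ℂ, y ^ 2 = eval x.rep B.eqn ∧ eval x.rep u + y * eval x.rep v = 0

end

/-! ### Local reducedness of `f = h = 0` where the differentials are independent. -/

open MvPolynomial

noncomputable section

/-! Let `Z` be `f = h = 0`, with `f`, `h` of degrees `k`, `k - d`. Suppose first that `d < k`. Since
`f`, `h` generate the ideal of all forms vanishing on `Z` (`IsTransverse.mem_span_pair`), a form
singular along `Z` can be written `w = p f + q h`, and on `Z` its gradient is `p df + q dh`; so `p`
and `q` vanish on `Z` too, and `w = α f² + β f h + γ h²` with `α` constant for degree reasons. If `k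
= d`, then `Z` is empty, `h` is a nonzero constant and every form has this shape
(`exists_quadForm_eq`).

For `α ≠ 0`, completing the square gives `w = a² - b h²`, with `b` proportional to the discriminant
`β² - 4αγ` (`exists_isTangentTriple`). When `b` is smooth, this identity yields tangency and the
lift (`mem_family`): on `b = 0` one has `w = a²`, and `dw = -h² db` at the contact points; on the
cover `y² = b` one has `w = (a + y h)(a - y h)`. Uniqueness of `A` comes from irreducibility of `b`
and from a degree bound: the double points being ordinary, `b` vanishes on no component of `Z`, so
if `b` divides a form of degree `k` vanishing on `Z`, the quotient vanishes on `Z`, has degree below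
`k - d`, and is zero.

The family exists because `a² - b h²` does not change under `a ↦ a + g h²`, `b ↦ b + 2 a g + g² h²`,
where `g` is any form of degree `2d - k`. Smoothness is open in `g`, and a hypersurface arises from
at most two `g` (`containsFamilyOfDim`).

For generality, `exists_general_certificate` gives one polynomial in the coefficients of `w` whose
non-vanishing allows the construction. Density in the class is checked on a line of triples `(α, β,
γ)` joining a given member to a good one. The ordinary double condition, which says that the
discriminant vanishes on no component of `Z` (`hasOrdinaryDouble_iff`), survives for all but
finitely many points of that line, because finitely many points of the affine cone over `Z` suffice
to test it (`exists_test_points`). -/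

theorem Derivation.mem_radical {A : Type*} [CommRing A] [Algebra ℚ A] (δ : Derivation ℚ A A)
    (J : Ideal A) (hδ : ∀ a ∈ J, δ a ∈ J) {a : A} (ha : a ∈ J.radical) : δ a ∈ J.radical := by
  obtain ⟨r, hr⟩ := ha
  -- Each differentiation trades one factor `a` for two factors `δ a`, after multiplying by `δ a`;
  -- the integer that appears is invertible over `ℚ`.
  have key : ∀ i, i ≤ r → a ^ (r - i) * δ a ^ (2 * i) ∈ J := by
    intro i
    induction i with
    | zero => intro _; simpa using hr
    | succ i ih =>
      intro hi
      have h1 := ih (by omega)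
      obtain ⟨s, hs⟩ : ∃ s, r = s + (i + 1) := ⟨r - (i + 1), by omega⟩
      have e1 : r - i = s + 1 := by omega
      have e2 : r - (i + 1) = s := by omega
      rw [e1] at h1
      rw [e2]
      have h2 := J.mul_mem_left (δ a) (hδ _ h1)
      rw [δ.leibniz, δ.leibniz_pow, δ.leibniz_pow] at h2
      simp only [smul_eq_mul, nsmul_eq_mul, Nat.add_sub_cancel] at h2
      have h3 : ((s + 1 : ℕ) : A) * (a ^ s * δ a ^ (2 * (i + 1))) ∈ J := by
        rcases Nat.eq_zero_or_pos i with rfl | hi0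
        · convert h2 using 1
          simp
          ring
        · have h4 := J.mul_mem_left (((2 * i : ℕ) : A) * δ (δ a)) h1
          convert J.sub_mem h2 h4 using 1
          obtain ⟨k, rfl⟩ : ∃ k, i = k + 1 := ⟨i - 1, by omega⟩
          have : 2 * (k + 1) - 1 = 2 * k + 1 := by omega
          rw [this]
          ring
      have h5 := J.mul_mem_left (algebraMap ℚ A (1 / ((s + 1 : ℕ) : ℚ))) h3
      rw [← mul_assoc, ← _root_.map_natCast (algebraMap ℚ A) (s + 1), ← map_mul,
        one_div_mul_cancel (by positivity), map_one, one_mul] at h5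
      exact h5
  refine ⟨2 * r, ?_⟩
  simpa using key r le_rfl

namespace MvPolynomial

variable {σ : Type*}

/-- The maximal ideal of a point of affine space. -/
abbrev pointIdeal (p : σ → ℂ) : Ideal (MvPolynomial σ ℂ) := RingHom.ker (eval p)

/-- First-order Taylor expansion: the Euler field centred at `p` acts as the identity on the linear
part of `G` at `p`. -/
theorem euler_sub_mem_sq [Fintype σ] (p : σ → ℂ) (G : MvPolynomial σ ℂ) :
    (∑ l, (X l - C (p l)) * pderiv l G) - (G - C (eval p G)) ∈ pointIdeal p ^ 2 := by
  have hX : ∀ l, X l - C (p l) ∈ pointIdeal p := fun l => by simp [RingHom.mem_ker]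
  classical
  induction G using MvPolynomial.induction_on with
  | C a => simp
  | add P Q hP hQ =>
    convert Ideal.add_mem _ hP hQ using 1
    simp only [map_add, mul_add, Finset.sum_add_distrib]
    ring
  | mul_X P i hP =>
    have h2 : (P - C (eval p P)) * (X i - C (p i)) ∈ pointIdeal p ^ 2 := by
      rw [pow_two]
      exact Ideal.mul_mem_mul (by simp [RingHom.mem_ker]) (hX i)
    convert Ideal.add_mem _ (Ideal.mul_mem_left _ (X i) hP) h2 using 1
    have : ∑ l, (X l - C (p l)) * pderiv l (P * X i) =
        X i * ∑ l, (X l - C (p l)) * pderiv l P + P * (X i - C (p i)) := by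
      simp only [Derivation.leibniz, smul_eq_mul, pderiv_X, mul_add, Finset.sum_add_distrib,
        Finset.mul_sum]
      rw [add_comm]
      congr 1
      · exact Finset.sum_congr rfl fun l _ => by ring
      · rw [Finset.sum_eq_single i]
        · simp; ring
        · intro b _ hb
          simp [hb.symm]
        · simp
    rw [this]
    simp only [map_mul, eval_X]
    ring

end MvPolynomial

theorem exists_minor_ne_zero {ι : Type*} {u v : ι → ℂ} (h : LinearIndependent ℂ ![u, v]) :
    ∃ i j, u i * v j - u j * v i ≠ 0 := by
  by_contra! H
  rw [LinearIndependent.pair_iff] at h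
  by_cases hu : u = 0
  · have := h 1 0 (by simp [hu])
    simp at this
  · obtain ⟨i, hi⟩ := Function.ne_iff.mp hu
    have := (h (v i) (-(u i)) (by
      funext j
      have := H i j
      simp only [Pi.add_apply, Pi.smul_apply, smul_eq_mul, Pi.zero_apply]
      linear_combination -this)).2
    exact hi (by simpa using this)

namespace MvPolynomial

variable {σ : Type*}

/-- The local form of the Jacobian criterion. An Euler-type field tangent to `f = h = 0` acts on
`m^N`, modulo `J + m^(N+1)`, as `N D` with `D` a unit at `p`. It also preserves the radical of `J`,
which is thereby pushed into every `J + m^N`; Krull's intersection theorem concludes. -/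
theorem exists_eval_ne_zero_mul_mem_of_mem_radical [Fintype σ] {f h F : MvPolynomial σ ℂ}
    {p : σ → ℂ} (hf : eval p f = 0) (hh : eval p h = 0)
    (hind : LinearIndependent ℂ ![fun i => eval p (pderiv i f), fun i => eval p (pderiv i h)])
    (hF : F ∈ (Ideal.span {f, h}).radical) :
    ∃ s, eval p s ≠ 0 ∧ s * F ∈ Ideal.span {f, h} := by
  classical
  obtain ⟨i, j, hij⟩ := exists_minor_ne_zero hind
  set J := Ideal.span {f, h} with hJ
  set m := pointIdeal p with hm
  set D := pderiv i f * pderiv j h - pderiv j f * pderiv i h with hD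
  have hfJ : f ∈ J := Ideal.subset_span (by simp)
  have hhJ : h ∈ J := Ideal.subset_span (by simp)
  have hDp : eval p D ≠ 0 := by simpa [hD] using hij
  have hJm : J ≤ m := by
    rw [hJ, Ideal.span_le]
    rintro x (rfl | rfl)
    · simpa [hm, RingHom.mem_ker] using hf
    · simpa [hm, RingHom.mem_ker] using hh
  -- `δ l G` is the Jacobian determinant of `G`, `f`, `h` in the variables `l`, `i`, `j`, so it
  -- kills `f` and `h`.
  let δ : σ → Derivation ℂ (MvPolynomial σ ℂ) (MvPolynomial σ ℂ) := fun l =>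
    D • pderiv l - (pderiv l f * pderiv j h - pderiv j f * pderiv l h) • pderiv i
      - (pderiv i f * pderiv l h - pderiv l f * pderiv i h) • pderiv j
  have hδ_apply : ∀ l G, δ l G = D * pderiv l G
      - (pderiv l f * pderiv j h - pderiv j f * pderiv l h) * pderiv i G
      - (pderiv i f * pderiv l h - pderiv l f * pderiv i h) * pderiv j G := fun l G => rfl
  have hδf : ∀ l, δ l f = 0 := fun l => by rw [hδ_apply, hD]; ring
  have hδh : ∀ l, δ l h = 0 := fun l => by rw [hδ_apply, hD]; ring
  have hδJ : ∀ l, ∀ a ∈ J, δ l a ∈ J := by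
    intro l a ha
    obtain ⟨u, v, rfl⟩ := Ideal.mem_span_pair.mp ha
    simp only [map_add, Derivation.leibniz, hδf, hδh, smul_eq_mul, mul_zero, zero_add]
    exact J.add_mem (J.mul_mem_right _ hfJ) (J.mul_mem_right _ hhJ)
  have hδrad : ∀ l, ∀ a ∈ J.radical, δ l a ∈ J.radical := fun l a ha =>
    Derivation.mem_radical ((δ l).restrictScalars ℚ) J (hδJ l) ha
  let E : Derivation ℂ (MvPolynomial σ ℂ) (MvPolynomial σ ℂ) := ∑ l, (X l - C (p l)) • δ l
  have hE_apply : ∀ G, E G = ∑ l, (X l - C (p l)) * δ l G := fun G => by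
    have h1 := map_sum (Derivation.coeFnAddMonoidHom (R := ℂ) (A := MvPolynomial σ ℂ)
      (M := MvPolynomial σ ℂ)) (fun l => (X l - C (p l)) • δ l) Finset.univ
    have h2 := congrFun h1 G
    rw [Finset.sum_apply] at h2
    exact h2
  have hXm : ∀ l, X l - C (p l) ∈ m := fun l => by simp [hm, RingHom.mem_ker]
  have heul : ∀ G ∈ m, (∑ l, (X l - C (p l)) * pderiv l G) - G ∈ J ⊔ m ^ 2 := by
    intro G hG
    have h1 := euler_sub_mem_sq p G
    rw [show eval p G = 0 from hG, C_0, sub_zero] at h1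
    exact (le_sup_right : m ^ 2 ≤ _) h1
  have heulJ : ∀ G ∈ J, (∑ l, (X l - C (p l)) * pderiv l G) ∈ J ⊔ m ^ 2 := by
    intro G hG
    have := Ideal.add_mem _ (heul G (hJm hG)) ((le_sup_left : J ≤ J ⊔ m ^ 2) hG)
    simpa using this
  have hE1 : ∀ G ∈ m, E G - D * G ∈ J ⊔ m ^ 2 := by
    intro G hG
    have e : E G - D * G = D * ((∑ l, (X l - C (p l)) * pderiv l G) - G)
        - (pderiv i G * pderiv j h - pderiv j G * pderiv i h) *
            (∑ l, (X l - C (p l)) * pderiv l f)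
        - (pderiv j G * pderiv i f - pderiv i G * pderiv j f) *
            (∑ l, (X l - C (p l)) * pderiv l h) := by
      have : E G = D * (∑ l, (X l - C (p l)) * pderiv l G)
        - (pderiv i G * pderiv j h - pderiv j G * pderiv i h) *
            (∑ l, (X l - C (p l)) * pderiv l f)
        - (pderiv j G * pderiv i f - pderiv i G * pderiv j f) *
            (∑ l, (X l - C (p l)) * pderiv l h) := by
        rw [hE_apply]
        simp only [hδ_apply, Finset.mul_sum, ← Finset.sum_sub_distrib]
        exact Finset.sum_congr rfl fun l _ => by ring
      rw [this]; ring
    rw [e]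
    exact Ideal.sub_mem _ (Ideal.sub_mem _ (Ideal.mul_mem_left _ _ (heul G hG))
      (Ideal.mul_mem_left _ _ (heulJ f hfJ))) (Ideal.mul_mem_left _ _ (heulJ h hhJ))
  have hEN : ∀ N : ℕ, ∀ G ∈ m ^ N, E G - N * D * G ∈ J ⊔ m ^ (N + 1) := by
    intro N
    induction N with
    | zero =>
      intro G _
      have : E G ∈ m := by
        rw [hE_apply]
        exact Ideal.sum_mem _ fun l _ => Ideal.mul_mem_right _ _ (hXm l)
      simpa using (le_sup_right : m ≤ J ⊔ m) this
    | succ N ih =>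
      intro G hG
      rw [pow_succ] at hG
      induction hG using Submodule.mul_induction_on' with
      | mem_mul_mem a ha b hb =>
        have e : E (a * b) - ((N + 1 : ℕ) : MvPolynomial σ ℂ) * D * (a * b) =
            (E b - D * b) * a + (E a - N * D * a) * b := by
          rw [E.leibniz]; simp only [smul_eq_mul]; push_cast; ring
        rw [e]
        have aux : ∀ s t x y, x ∈ J ⊔ m ^ s → y ∈ m ^ t → x * y ∈ J ⊔ m ^ (s + t) := by
          intro s t x y hx hy
          obtain ⟨x1, hx1, x2, hx2, rfl⟩ := Submodule.mem_sup.mp hx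
          rw [add_mul]
          refine Ideal.add_mem _ ((le_sup_left : J ≤ _) (J.mul_mem_right _ hx1))
            ((le_sup_right : m ^ (s + t) ≤ _) ?_)
          rw [pow_add]
          exact Ideal.mul_mem_mul hx2 hy
        refine Ideal.add_mem _ ?_ ?_
        · have := aux 2 N _ _ (hE1 b hb) ha
          rwa [show 2 + N = N + 1 + 1 by ring] at this
        · exact aux (N + 1) 1 _ _ (ih a ha) (by simpa using hb)
      | add a _ b _ ha hb =>
        convert Ideal.add_mem _ ha hb using 1
        rw [map_add]; ring
  -- `D` lies outside the maximal ideal `m`, so it is invertible modulo each `m ^ N`.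
  have hunit : ∀ (N : ℕ) (G : MvPolynomial σ ℂ), D * G ∈ J ⊔ m ^ N → G ∈ J ⊔ m ^ N := by
    intro N G hG
    have hmax : m.IsMaximal := RingHom.ker_isMaximal_of_surjective _ fun z => ⟨C z, by simp⟩
    have hDm : D ∉ m := hDp
    have hcop : Ideal.span {D} ⊔ m = ⊤ := by
      rw [sup_comm]
      exact hmax.1.2 _ (lt_of_le_of_ne le_sup_left fun e => hDm (by
        rw [e]; exact (le_sup_right : Ideal.span {D} ≤ _) (Ideal.mem_span_singleton_self D)))
    have hcopN : Ideal.span {D} ⊔ m ^ N = ⊤ := Ideal.sup_pow_eq_top hcop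
    obtain ⟨a, ha, b, hb, hab⟩ := Submodule.mem_sup.mp
      (show (1 : MvPolynomial σ ℂ) ∈ Ideal.span {D} ⊔ m ^ N by rw [hcopN]; trivial)
    obtain ⟨c, rfl⟩ := Ideal.mem_span_singleton'.mp ha
    have : G = c * (D * G) + b * G := by linear_combination -G * hab
    rw [this]
    exact Ideal.add_mem _ (Ideal.mul_mem_left _ _ hG)
      (Ideal.mul_mem_right _ _ ((le_sup_right : m ^ N ≤ _) hb))
  -- Compute `E G` twice. Each `δ l G` is in the radical, so the extra factor `X l - p l` gains one
  -- order; on the other hand `E G` is `(N + 1) D G` modulo `J + m^(N+2)`.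
  have hmain : ∀ N : ℕ, ∀ G ∈ J.radical, G ∈ J ⊔ m ^ (N + 1) := by
    intro N
    induction N with
    | zero =>
      intro G hG
      have hmp : m.IsPrime := RingHom.ker_isPrime _
      have : G ∈ m := hmp.radical_le_iff.mpr hJm hG
      simpa using (le_sup_right : m ≤ J ⊔ m) this
    | succ N ih =>
      intro G hG
      apply hunit
      have h1 : E G ∈ J ⊔ m ^ (N + 1 + 1) := by
        rw [hE_apply]
        refine Ideal.sum_mem _ fun l _ => ?_
        obtain ⟨x1, hx1, x2, hx2, hx⟩ := Submodule.mem_sup.mp (ih _ (hδrad l G hG))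
        rw [← hx, mul_add]
        refine Ideal.add_mem _ ((le_sup_left : J ≤ _) (J.mul_mem_left _ hx1))
          ((le_sup_right : m ^ (N + 1 + 1) ≤ _) ?_)
        rw [pow_succ', mul_comm]
        rw [mul_comm]
        exact Ideal.mul_mem_mul (hXm l) hx2
      have h2 : ((N + 1 : ℕ) : MvPolynomial σ ℂ) * (D * G) ∈ J ⊔ m ^ (N + 1 + 1) := by
        obtain ⟨x1, hx1, x2, hx2, hx⟩ := Submodule.mem_sup.mp (ih G hG)
        have hEx1 : E x1 ∈ J := by
          rw [hE_apply]
          exact Ideal.sum_mem _ fun l _ => J.mul_mem_left _ (hδJ l _ hx1)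
        have h3 := hEN (N + 1) x2 hx2
        have e : ((N + 1 : ℕ) : MvPolynomial σ ℂ) * (D * G) =
            E G - (E x2 - ((N + 1 : ℕ) : MvPolynomial σ ℂ) * D * x2)
              + (((N + 1 : ℕ) : MvPolynomial σ ℂ) * D * x1 - E x1) := by
          rw [← hx, map_add]; ring
        rw [e]
        exact Ideal.add_mem _ (Ideal.sub_mem _ h1 h3) ((le_sup_left : J ≤ _)
          (J.sub_mem (J.mul_mem_left _ hx1) hEx1))
      have h5 := Ideal.mul_mem_left _ (C (1 / ((N + 1 : ℕ) : ℂ))) h2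
      rwa [← mul_assoc, ← map_natCast C (N + 1), ← map_mul,
        one_div_mul_cancel (by exact_mod_cast Nat.succ_ne_zero N), map_one, one_mul] at h5
  have hinf : (Ideal.Quotient.mk J F : MvPolynomial σ ℂ ⧸ J) ∈
      (⨅ i : ℕ, m ^ i • ⊤ : Submodule (MvPolynomial σ ℂ) (MvPolynomial σ ℂ ⧸ J)) := by
    rw [Submodule.mem_iInf]
    intro N
    obtain ⟨x1, hx1, x2, hx2, hx⟩ := Submodule.mem_sup.mp (hmain N F hF)
    have : (Ideal.Quotient.mk J F : MvPolynomial σ ℂ ⧸ J) =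
        x2 • (1 : MvPolynomial σ ℂ ⧸ J) := by
      rw [← hx, map_add, Ideal.Quotient.eq_zero_iff_mem.mpr hx1, zero_add]
      exact (congrArg (Ideal.Quotient.mk J) (mul_one x2)).symm
    rw [this]
    exact Submodule.smul_mem_smul (Ideal.pow_le_pow_right (Nat.le_succ N) hx2) trivial
  obtain ⟨⟨r, hr⟩, hrF⟩ := (Ideal.mem_iInf_smul_pow_eq_bot_iff m _).mp hinf
  refine ⟨1 - r, ?_, ?_⟩
  · have : eval p r = 0 := hr
    simp [this]
  · rw [← Ideal.Quotient.eq_zero_iff_mem]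
    have h6 : r • (Ideal.Quotient.mk J F : MvPolynomial σ ℂ ⧸ J) = Ideal.Quotient.mk J F := hrF
    have h7 : Ideal.Quotient.mk J r * Ideal.Quotient.mk J F = Ideal.Quotient.mk J F := h6
    rw [map_mul, map_sub, map_one, sub_mul, h7, one_mul, sub_self]

end MvPolynomial

namespace MvPolynomial

/-! ### Homogeneous components and factors of forms. -/

section Homogeneous

variable {σ K : Type*} [Field K]

theorem homogeneousComponent_mul_of_isHomogeneous {a b : MvPolynomial σ K} {e : ℕ}
    (hb : b.IsHomogeneous e) (m : ℕ) :
    homogeneousComponent (m + e) (a * b) = homogeneousComponent m a * b := by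
  conv_lhs => rw [← sum_homogeneousComponent a, Finset.sum_mul, map_sum]
  have h : ∀ i, homogeneousComponent (m + e) (homogeneousComponent i a * b) =
      if i = m then homogeneousComponent i a * b else 0 := fun i => by
    rw [homogeneousComponent_of_mem ((homogeneousComponent_isHomogeneous i a).mul hb)]
    simp [Nat.add_right_cancel_iff, eq_comm]
  simp only [h, Finset.sum_ite_eq', Finset.mem_range]
  split_ifs with hm
  · rfl
  · rw [homogeneousComponent_eq_zero _ _ (by omega), zero_mul]

theorem homogeneousComponent_mul_of_lt {a b : MvPolynomial σ K} {e N : ℕ}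
    (hb : b.IsHomogeneous e) (hN : N < e) : homogeneousComponent N (a * b) = 0 := by
  conv_lhs => rw [← sum_homogeneousComponent a, Finset.sum_mul, map_sum]
  refine Finset.sum_eq_zero fun i _ => ?_
  rw [homogeneousComponent_of_mem ((homogeneousComponent_isHomogeneous i a).mul hb)]
  rw [if_neg (by omega)]

theorem exists_homogeneousComponent_mul {F f a : MvPolynomial σ K} {N e : ℕ}
    (hf : f.IsHomogeneous e) (ha : F = homogeneousComponent N (a * f)) :
    ∃ p, F = p * f ∧ p.IsHomogeneous (N - e) ∧ (N < e → p = 0) := by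
  by_cases hN : N < e
  · exact ⟨0, by rw [ha, homogeneousComponent_mul_of_lt hf hN, zero_mul],
      isHomogeneous_zero _ _ _, fun _ => rfl⟩
  · refine ⟨homogeneousComponent (N - e) a, ?_, homogeneousComponent_isHomogeneous _ _,
      fun h => absurd h hN⟩
    rw [ha, ← homogeneousComponent_mul_of_isHomogeneous hf, Nat.sub_add_cancel (by omega)]

theorem IsHomogeneous.exists_eq_of_dvd {F f : MvPolynomial σ K} {N e : ℕ}
    (hF : F.IsHomogeneous N) (hf : f.IsHomogeneous e) (hd : f ∣ F) :
    ∃ p, F = p * f ∧ p.IsHomogeneous (N - e) ∧ (N < e → p = 0) := by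
  obtain ⟨p, rfl⟩ := hd
  refine exists_homogeneousComponent_mul hf (a := p) ?_
  rw [mul_comm p, homogeneousComponent_of_mem hF, if_pos rfl]

theorem IsHomogeneous.exists_eq_of_mem_span_pair {F f h : MvPolynomial σ K} {N a b : ℕ}
    (hF : F.IsHomogeneous N) (hf : f.IsHomogeneous a) (hh : h.IsHomogeneous b)
    (hmem : F ∈ Ideal.span {f, h}) :
    ∃ p q, F = p * f + q * h ∧ p.IsHomogeneous (N - a) ∧ (N < a → p = 0) ∧
      q.IsHomogeneous (N - b) ∧ (N < b → q = 0) := by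
  obtain ⟨u, v, huv⟩ := Ideal.mem_span_pair.mp hmem
  obtain ⟨p, hp, hp1, hp2⟩ := exists_homogeneousComponent_mul (N := N) (a := u) hf rfl
  obtain ⟨q, hq, hq1, hq2⟩ := exists_homogeneousComponent_mul (N := N) (a := v) hh rfl
  refine ⟨p, q, ?_, hp1, hp2, hq1, hq2⟩
  rw [← hp, ← hq, ← map_add, huv, homogeneousComponent_of_mem hF, if_pos rfl]

/-- The substitution `X i ↦ t X i`, with `t` a new variable. -/
def gradingHom (σ K : Type*) [Field K] : MvPolynomial σ K →ₐ[K] Polynomial (MvPolynomial σ K) :=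
  aeval fun i => Polynomial.C (X i) * Polynomial.X

theorem gradingHom_of_isHomogeneous {P : MvPolynomial σ K} {e : ℕ} (hP : P.IsHomogeneous e) :
    gradingHom σ K P = Polynomial.C P * Polynomial.X ^ e := by
  conv_lhs => rw [P.as_sum]
  conv_rhs => rw [P.as_sum]
  rw [map_sum, map_sum, Finset.sum_mul]
  refine Finset.sum_congr rfl fun s hs => ?_
  have hdeg : ∑ i ∈ s.support, s i = e := (hP.degree_eq_sum_deg_support hs).symm
  rw [gradingHom, aeval_monomial, Finsupp.prod, monomial_eq, Finsupp.prod]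
  simp only [mul_pow, Finset.prod_mul_distrib, Finset.prod_pow_eq_pow_sum, hdeg, map_mul,
    map_prod, map_pow]
  rw [← mul_assoc]
  rfl

theorem coeff_gradingHom (P : MvPolynomial σ K) (m : ℕ) :
    (gradingHom σ K P).coeff m = homogeneousComponent m P := by
  conv_lhs => rw [← sum_homogeneousComponent P, map_sum, Polynomial.finsetSum_coeff]
  simp only [gradingHom_of_isHomogeneous (homogeneousComponent_isHomogeneous _ P),
    Polynomial.coeff_C_mul, Polynomial.coeff_X_pow]
  simp only [mul_ite, mul_one, mul_zero, Finset.sum_ite_eq, Finset.mem_range]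
  split_ifs with h
  · rfl
  · rw [homogeneousComponent_eq_zero _ _ (by omega)]

theorem isHomogeneous_of_coeff_gradingHom {P : MvPolynomial σ K} {i : ℕ}
    (h : ∀ m, m ≠ i → (gradingHom σ K P).coeff m = 0) : P.IsHomogeneous i := by
  have : P = homogeneousComponent i P := by
    conv_lhs => rw [← sum_homogeneousComponent P]
    simp only [← coeff_gradingHom]
    by_cases hi : i < P.totalDegree + 1
    · exact Finset.sum_eq_single_of_mem i (Finset.mem_range.mpr hi) fun m _ hm => h m hm
    · rw [Finset.sum_eq_zero, coeff_gradingHom, homogeneousComponent_eq_zero _ _ (by omega)]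
      intro m hm
      exact h m (by rw [Finset.mem_range] at hm; omega)
  rw [this]
  exact homogeneousComponent_isHomogeneous _ _

/-- Under `X i ↦ t X i` the product becomes a monomial in `t`. Degree and trailing degree in `t` are
both additive, so they agree on each factor. -/
theorem IsHomogeneous.of_mul {P Q : MvPolynomial σ K} {e : ℕ} (h : (P * Q).IsHomogeneous e)
    (h0 : P * Q ≠ 0) : ∃ i j, P.IsHomogeneous i ∧ Q.IsHomogeneous j ∧ i + j = e := by
  set p := gradingHom σ K P with hp
  set q := gradingHom σ K Q with hq
  have hinj : ∀ A : MvPolynomial σ K, gradingHom σ K A = 0 → A = 0 := by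
    intro A hA
    rw [← sum_homogeneousComponent A]
    exact Finset.sum_eq_zero fun m _ => by rw [← coeff_gradingHom, hA, Polynomial.coeff_zero]
  have hP0 : p ≠ 0 := fun e0 => h0 (by rw [hinj P e0, zero_mul])
  have hQ0 : q ≠ 0 := fun e0 => h0 (by rw [hinj Q e0, mul_zero])
  have hpq : p * q = Polynomial.C (P * Q) * Polynomial.X ^ e := by
    rw [hp, hq, ← map_mul, gradingHom_of_isHomogeneous h]
  have h1 : p.natDegree + q.natDegree = e := by
    rw [← Polynomial.natDegree_mul hP0 hQ0, hpq, Polynomial.natDegree_C_mul_X_pow _ _ h0]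
  have h2 : p.natTrailingDegree + q.natTrailingDegree = e := by
    rw [← Polynomial.natTrailingDegree_mul hP0 hQ0, hpq, Polynomial.C_mul_X_pow_eq_monomial,
      Polynomial.natTrailingDegree_monomial h0]
  have h3 := p.natTrailingDegree_le_natDegree
  have h4 := q.natTrailingDegree_le_natDegree
  have aux : ∀ r : Polynomial (MvPolynomial σ K), r.natTrailingDegree = r.natDegree →
      ∀ m, m ≠ r.natDegree → r.coeff m = 0 := by
    intro r hr m hm
    rcases lt_or_gt_of_ne hm with h5 | h5
    · exact Polynomial.coeff_eq_zero_of_lt_natTrailingDegree (by omega)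
    · exact Polynomial.coeff_eq_zero_of_natDegree_lt h5
  exact ⟨p.natDegree, q.natDegree, isHomogeneous_of_coeff_gradingHom (aux p (by omega)),
    isHomogeneous_of_coeff_gradingHom (aux q (by omega)), h1⟩

theorem IsHomogeneous.of_dvd {P Q : MvPolynomial σ K} {e : ℕ} (h : Q.IsHomogeneous e)
    (h0 : Q ≠ 0) (hd : P ∣ Q) : ∃ i, P.IsHomogeneous i := by
  obtain ⟨R, rfl⟩ := hd
  obtain ⟨i, _, hi, _⟩ := h.of_mul h0
  exact ⟨i, hi⟩

theorem IsHomogeneous.eq_C {P : MvPolynomial σ K} (h : P.IsHomogeneous 0) :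
    P = C (coeff 0 P) :=
  (totalDegree_eq_zero_iff_eq_C).mp (Nat.le_zero.mp h.totalDegree_le)

theorem IsHomogeneous.isUnit_of_ne_zero {P : MvPolynomial σ K} (h : P.IsHomogeneous 0)
    (h0 : P ≠ 0) : IsUnit P := by
  rw [h.eq_C] at h0 ⊢
  exact (IsUnit.mk0 _ fun e => h0 (by rw [e, C_0])).map C

theorem IsHomogeneous.eval_smul {P : MvPolynomial σ K} {e : ℕ} (h : P.IsHomogeneous e) (c : K)
    (x : σ → K) : eval (c • x) P = c ^ e * eval x P := by
  rw [eval_eq, eval_eq, Finset.mul_sum]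
  refine Finset.sum_congr rfl fun s hs => ?_
  have hdeg : ∑ i ∈ s.support, s i = e := (h.degree_eq_sum_deg_support hs).symm
  simp only [Pi.smul_apply, smul_eq_mul, mul_pow, Finset.prod_mul_distrib,
    Finset.prod_pow_eq_pow_sum, hdeg]
  ring

theorem IsHomogeneous.eval_zero {P : MvPolynomial σ K} {e : ℕ} (h : P.IsHomogeneous e)
    (he : e ≠ 0) : eval 0 P = 0 := by
  have := h.eval_smul 0 0
  rwa [zero_smul, zero_pow he, zero_mul] at this

end Homogeneous

/-! ### Saturation of `(f, h)` and existence of common zeros. -/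

section Irrelevant

variable {n : ℕ}

theorem exists_pow_le_of_zeroLocus_subset {σ : Type*} [Finite σ] {I : Ideal (MvPolynomial σ ℂ)}
    (h : ∀ x ∈ zeroLocus ℂ I, x = 0) : ∃ M, pointIdeal (0 : σ → ℂ) ^ M ≤ I := by
  have hrad : pointIdeal (0 : σ → ℂ) ≤ I.radical := by
    rw [← vanishingIdeal_zeroLocus_eq_radical (K := ℂ)]
    intro P hP x hx
    rw [h x hx]
    simpa [RingHom.mem_ker] using hP
  exact Ideal.exists_pow_le_of_le_radical_of_fg hrad (IsNoetherian.noetherian _)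

theorem sub_aeval_mem {σ : Type*} {I : Ideal (MvPolynomial σ ℂ)} {g : σ → MvPolynomial σ ℂ}
    (hg : ∀ i, X i - g i ∈ I) (G : MvPolynomial σ ℂ) : G - aeval g G ∈ I := by
  rw [← Ideal.Quotient.eq]
  have : (Ideal.Quotient.mkₐ ℂ I) = (Ideal.Quotient.mkₐ ℂ I).comp (aeval g) := by
    ext i
    simpa using Ideal.Quotient.eq.mpr (hg i)
  exact DFunLike.congr_fun this G

/-- The irrelevant ideal is not associated to `(f, h)`. Take independent linear forms `s`, `t`
vanishing at a point where `h` does not. Comparing the expressions of `s F` and `t F` gives a syzygy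
of `f`, `h`, which is Koszul with some multiplier `r`. As `h` is nonzero modulo the prime `(s, t)`,
`r` lies in `(s, t)`; correcting the expressions by `r` makes the one for `s F` divisible by `s`. -/
theorem mem_span_pair_of_forall_mul_mem (hn : 2 ≤ n) {f h F : MvPolynomial (Fin (n + 1)) ℂ}
    (hfh : IsRelPrime f h) (hh : h ≠ 0)
    (hF : ∀ G ∈ pointIdeal (0 : Fin (n + 1) → ℂ), G * F ∈ Ideal.span {f, h}) :
    F ∈ Ideal.span {f, h} := by
  obtain ⟨i1, i2, h10, h20, h12⟩ : ∃ i1 i2 : Fin (n + 1), i1 ≠ 0 ∧ i2 ≠ 0 ∧ i1 ≠ i2 :=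
    ⟨⟨1, by omega⟩, ⟨2, by omega⟩, by simp [Fin.ext_iff], by simp [Fin.ext_iff],
      by simp [Fin.ext_iff]⟩
  obtain ⟨u, hu⟩ : ∃ u : Fin (n + 1) → ℂ, eval u (h * X 0) ≠ 0 := by
    by_contra! H
    exact mul_ne_zero hh (X_ne_zero 0) (MvPolynomial.funext fun x => by rw [H x, map_zero])
  rw [map_mul, eval_X] at hu
  have hu0 : u 0 ≠ 0 := right_ne_zero_of_mul hu
  have huh : eval u h ≠ 0 := left_ne_zero_of_mul hu
  let g1 : Fin (n + 1) → MvPolynomial (Fin (n + 1)) ℂ := fun i =>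
    if i = i1 then C (u i / u 0) * X 0 else X i
  let g2 : Fin (n + 1) → MvPolynomial (Fin (n + 1)) ℂ := fun i =>
    if i = i1 ∨ i = i2 then C (u i / u 0) * X 0 else X i
  set s : MvPolynomial (Fin (n + 1)) ℂ := X i1 - C (u i1 / u 0) * X 0 with hs
  set t : MvPolynomial (Fin (n + 1)) ℂ := X i2 - C (u i2 / u 0) * X 0 with ht
  have hg1 : ∀ i, X i - g1 i ∈ Ideal.span {s} := by
    intro i
    by_cases hi : i = i1
    · subst hi
      simp [g1, hs]
    · simp [g1, hi]
  have hg2 : ∀ i, X i - g2 i ∈ Ideal.span {s, t} := by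
    intro i
    by_cases hi : i = i1
    · subst hi
      have : s ∈ Ideal.span {s, t} := Ideal.subset_span (by simp)
      simpa [g2, hs] using this
    · by_cases hi' : i = i2
      · subst hi'
        have : t ∈ Ideal.span {s, t} := Ideal.subset_span (by simp)
        simpa [g2, ht] using this
      · simp [g2, hi, hi']
  have e1s : aeval g1 s = 0 := by
    simp [hs, g1, h10.symm]
  have e1t : aeval g1 t = t := by
    simp [ht, g1, h10.symm, h12.symm]
  have e2s : aeval g2 s = 0 := by
    simp [hs, g2, h10.symm, h20.symm]
  have e2t : aeval g2 t = 0 := by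
    simp [ht, g2, h10.symm, h20.symm]
  have e2h : aeval g2 h ≠ 0 := by
    intro e
    have h3 : h - aeval g2 h ∈ pointIdeal u := sub_aeval_mem (fun i => by
      by_cases hi : i = i1 ∨ i = i2 <;> simp [RingHom.mem_ker, g2, hi, hu0]) h
    rw [e, sub_zero] at h3
    exact huh h3
  have hne : ∀ i : Fin (n + 1), i ≠ 0 → ∀ c : ℂ,
      (X i - C c * X 0 : MvPolynomial (Fin (n + 1)) ℂ) ≠ 0 := by
    intro i hi c e
    have := congrArg (eval (Pi.single i 1)) e
    simp [hi.symm] at this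
  have hs0 : s ≠ 0 := hne i1 h10 _
  have ht0 : t ≠ 0 := hne i2 h20 _
  obtain ⟨p1, q1, hpq1⟩ := Ideal.mem_span_pair.mp (hF s (by simp [RingHom.mem_ker, hs]))
  obtain ⟨p2, q2, hpq2⟩ := Ideal.mem_span_pair.mp (hF t (by simp [RingHom.mem_ker, ht]))
  have hsyz : (t * p1 - s * p2) * f = -(t * q1 - s * q2) * h := by
    linear_combination t * hpq1 - s * hpq2
  have hdvd : h ∣ t * p1 - s * p2 :=
    hfh.symm.dvd_of_dvd_mul_right (Dvd.intro_left _ hsyz.symm)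
  obtain ⟨r, hr⟩ := hdvd
  have hr' : t * q1 - s * q2 = -(r * f) := by
    apply mul_right_cancel₀ hh
    linear_combination hsyz - f * hr
  have hrst : r ∈ Ideal.span {s, t} := by
    have h4 := congrArg (aeval g2) hr
    simp only [map_sub, map_mul, e2s, e2t, zero_mul, sub_zero] at h4
    have h5 : aeval g2 r = 0 := (mul_eq_zero.mp h4.symm).resolve_left e2h
    have h6 := sub_aeval_mem hg2 r
    rwa [h5, sub_zero] at h6
  obtain ⟨r1, r2, hr12⟩ := Ideal.mem_span_pair.mp hrst
  have key : ∀ A B : MvPolynomial (Fin (n + 1)) ℂ, t * A = s * B → ∃ e, A = e * s := by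
    intro A B hAB
    have h4 := congrArg (aeval g1) hAB
    simp only [map_mul, e1s, e1t, zero_mul] at h4
    have h5 : aeval g1 A = 0 := (mul_eq_zero.mp h4).resolve_left ht0
    have h6 := sub_aeval_mem hg1 A
    rw [h5, sub_zero] at h6
    obtain ⟨e, he⟩ := Ideal.mem_span_singleton'.mp h6
    exact ⟨e, he.symm⟩
  obtain ⟨e, he⟩ := key (p1 - r2 * h) (p2 + r1 * h) (by
    linear_combination hr - h * hr12)
  obtain ⟨e', he'⟩ := key (q1 + r2 * f) (q2 - r1 * f) (by
    linear_combination hr' + f * hr12)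
  refine Ideal.mem_span_pair.mpr ⟨e, e', ?_⟩
  apply mul_left_cancel₀ hs0
  linear_combination hpq1 - f * he - h * he'

theorem mem_span_pair_of_pow_mul_mem (hn : 2 ≤ n) {f h : MvPolynomial (Fin (n + 1)) ℂ}
    (hfh : IsRelPrime f h) (hh : h ≠ 0) (M : ℕ) (F : MvPolynomial (Fin (n + 1)) ℂ)
    (hF : ∀ G ∈ pointIdeal (0 : Fin (n + 1) → ℂ) ^ M, G * F ∈ Ideal.span {f, h}) :
    F ∈ Ideal.span {f, h} := by
  induction M generalizing F with
  | zero => simpa using hF 1 (by simp)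
  | succ M ih =>
    apply ih
    intro G hG
    apply mem_span_pair_of_forall_mul_mem hn hfh hh
    intro H hH
    rw [← mul_assoc, mul_comm H]
    exact hF _ (by rw [pow_succ]; exact Ideal.mul_mem_mul hG hH)

/-- Without such a zero, the Nullstellensatz makes `P` divide powers of two distinct variables,
hence a unit. -/
theorem exists_ne_zero_eval_eq_zero (hn : 1 ≤ n) {P : MvPolynomial (Fin (n + 1)) ℂ} {e : ℕ}
    (hP : P.IsHomogeneous e) (he : 1 ≤ e) : ∃ x : Fin (n + 1) → ℂ, x ≠ 0 ∧ eval x P = 0 := by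
  by_contra! H
  have hP0 : P ≠ 0 := by
    rintro rfl
    exact H (fun _ => 1) (fun h => one_ne_zero (congrFun h 0)) (map_zero _)
  obtain ⟨M, hM⟩ := exists_pow_le_of_zeroLocus_subset (I := Ideal.span {P}) (by
    intro x hx
    by_contra hx0
    exact H x hx0 (by simpa using hx P (Ideal.mem_span_singleton_self P)))
  have hX : ∀ i, P ∣ X i ^ M := fun i => Ideal.mem_span_singleton.mp
    (hM (Ideal.pow_mem_pow (by simp [RingHom.mem_ker]) M))
  have hrel : IsRelPrime (X 0 ^ M : MvPolynomial (Fin (n + 1)) ℂ) (X (Fin.last n) ^ M) := by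
    apply IsRelPrime.pow
    rw [(X_prime (R := ℂ) (i := (0 : Fin (n + 1)))).irreducible.isRelPrime_iff_not_dvd]
    rintro ⟨Q, hQ⟩
    have := congrArg (eval (Pi.single (Fin.last n) 1)) hQ
    have h0 : (0 : Fin (n + 1)) ≠ Fin.last n := by
      rw [Ne, Fin.ext_iff]; simp; omega
    simp [h0] at this
  have hu : IsUnit P := hrel (hX 0) (hX _)
  have := hu.map (eval 0)
  rw [hP.eval_zero (by omega)] at this
  exact not_isUnit_zero this

/-- If `P`, `Q` are coprime without common zero, `(P, Q)` contains a power of the irrelevant ideal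
and is saturated, so it contains `1`, which is false at the origin. Otherwise a zero of a common
factor works. -/
theorem exists_common_zero (hn : 2 ≤ n) {P Q : MvPolynomial (Fin (n + 1)) ℂ} {a b : ℕ}
    (hP : P.IsHomogeneous a) (ha : 1 ≤ a) (hQ : Q.IsHomogeneous b) (hb : 1 ≤ b) :
    ∃ x : Fin (n + 1) → ℂ, x ≠ 0 ∧ eval x P = 0 ∧ eval x Q = 0 := by
  by_cases hQ0 : Q = 0
  · obtain ⟨x, hx, hx'⟩ := exists_ne_zero_eval_eq_zero (by omega) hP ha
    exact ⟨x, hx, hx', by rw [hQ0, map_zero]⟩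
  by_cases hrel : IsRelPrime P Q
  · by_contra! H
    obtain ⟨M, hM⟩ := exists_pow_le_of_zeroLocus_subset (I := Ideal.span {P, Q}) (by
      intro x hx
      by_contra hx0
      exact H x hx0 (by simpa using hx P (Ideal.subset_span (by simp)))
        (by simpa using hx Q (Ideal.subset_span (by simp))))
    have h1 : (1 : MvPolynomial (Fin (n + 1)) ℂ) ∈ Ideal.span {P, Q} :=
      mem_span_pair_of_pow_mul_mem hn hrel hQ0 M 1 fun G hG => by simpa using hM hG
    obtain ⟨u, v, huv⟩ := Ideal.mem_span_pair.mp h1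
    have := congrArg (eval 0) huv
    rw [map_add, map_mul, map_mul, hP.eval_zero (by omega), hQ.eval_zero (by omega)] at this
    simp at this
  · rw [IsRelPrime] at hrel
    push Not at hrel
    obtain ⟨p, ⟨r, hr⟩, ⟨s, hs⟩, hu⟩ := hrel
    obtain ⟨i, hi⟩ := hQ.of_dvd hQ0 ⟨s, hs⟩
    have hp0 : p ≠ 0 := by rintro rfl; exact hQ0 (by rw [hs, zero_mul])
    have hi1 : 1 ≤ i := by
      by_contra h
      obtain rfl : i = 0 := by omega
      exact hu (hi.isUnit_of_ne_zero hp0)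
    obtain ⟨x, hx, hx'⟩ := exists_ne_zero_eval_eq_zero (by omega) hi hi1
    exact ⟨x, hx, by rw [hr, map_mul, hx', zero_mul], by rw [hs, map_mul, hx', zero_mul]⟩

end Irrelevant

/-! ### Irreducibility of smooth forms; the ideal of a smooth complete intersection and its square.
-/

section Smooth

variable {n : ℕ}

/-- Two factors of positive degree would meet, and their product is singular where they meet. -/
theorem irreducible_of_smooth (hn : 2 ≤ n) {B : MvPolynomial (Fin (n + 1)) ℂ} {e : ℕ}
    (hB : B.IsHomogeneous e) (he : 1 ≤ e)
    (hs : ∀ x : Fin (n + 1) → ℂ, x ≠ 0 → eval x B = 0 → gradAt B x ≠ 0) : Irreducible B := by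
  have hB0 : B ≠ 0 := by
    rintro rfl
    exact hs (fun _ => 1) (fun h => one_ne_zero (congrFun h 0)) (map_zero _)
      (by ext i; simp [gradAt])
  refine ⟨fun hu => ?_, fun P Q hPQ => ?_⟩
  · have := hu.map (eval 0)
    rw [hB.eval_zero (by omega)] at this
    exact not_isUnit_zero this
  · obtain ⟨i, j, hi, hj, -⟩ := IsHomogeneous.of_mul (hPQ ▸ hB) (hPQ ▸ hB0)
    have hP0 : P ≠ 0 := by rintro rfl; exact hB0 (by rw [hPQ, zero_mul])
    have hQ0 : Q ≠ 0 := by rintro rfl; exact hB0 (by rw [hPQ, mul_zero])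
    rcases Nat.eq_zero_or_pos i with rfl | hi1
    · exact Or.inl (hi.isUnit_of_ne_zero hP0)
    rcases Nat.eq_zero_or_pos j with rfl | hj1
    · exact Or.inr (hj.isUnit_of_ne_zero hQ0)
    obtain ⟨x, hx, hxP, hxQ⟩ := exists_common_zero hn hi hi1 hj hj1
    refine absurd ?_ (hs x hx (by rw [hPQ, map_mul, hxP, zero_mul]))
    ext l
    simp [gradAt, hPQ, hxP, hxQ]

/-- The forms `f` and `h` have independent differentials at each of their common zeros. -/
def IsTransverse (f h : MvPolynomial (Fin (n + 1)) ℂ) : Prop :=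
  ∀ x : Fin (n + 1) → ℂ, x ≠ 0 → eval x f = 0 → eval x h = 0 →
    LinearIndependent ℂ ![gradAt f x, gradAt h x]

theorem IsTransverse.isRelPrime (hn : 2 ≤ n) {f h : MvPolynomial (Fin (n + 1)) ℂ} {a b : ℕ}
    (hfh : IsTransverse f h) (hf : f.IsHomogeneous a) (ha : 1 ≤ a) (hh : h.IsHomogeneous b)
    (hb : 1 ≤ b) : f ≠ 0 ∧ h ≠ 0 ∧ IsRelPrime f h := by
  have key : ∀ p r s : MvPolynomial (Fin (n + 1)) ℂ, ∀ i, p.IsHomogeneous i → 1 ≤ i →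
      f = p * r → h = p * s → ∀ x : Fin (n + 1) → ℂ, x ≠ 0 → eval x p = 0 → False := by
    intro p r s i hi hi1 hr hs x hx hxp
    have hind := hfh x hx (by rw [hr, map_mul, hxp, zero_mul]) (by rw [hs, map_mul, hxp, zero_mul])
    obtain ⟨i, j, hij⟩ := exists_minor_ne_zero hind
    apply hij
    simp only [gradAt, hr, hs, Derivation.leibniz, smul_eq_mul, map_add, map_mul, hxp]
    ring
  obtain ⟨x, hx, hxf, hxh⟩ := exists_common_zero hn hf ha hh hb
  have hind := hfh x hx hxf hxh
  have hf0 : f ≠ 0 := by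
    rintro rfl
    exact hind.ne_zero 0 (by ext i; simp [gradAt])
  have hh0 : h ≠ 0 := by
    rintro rfl
    exact hind.ne_zero 1 (by ext i; simp [gradAt])
  refine ⟨hf0, hh0, fun p hpf hph => ?_⟩
  obtain ⟨i, hi⟩ := hf.of_dvd hf0 hpf
  obtain ⟨r, hr⟩ := hpf
  obtain ⟨s, hs⟩ := hph
  by_contra hu
  have hp0 : p ≠ 0 := by rintro rfl; exact hf0 (by rw [hr, zero_mul])
  have hi1 : 1 ≤ i := by
    by_contra h
    obtain rfl : i = 0 := by omega
    exact hu (hi.isUnit_of_ne_zero hp0)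
  obtain ⟨x, hx, hx'⟩ := exists_ne_zero_eval_eq_zero (by omega) hi hi1
  exact key p r s i hi hi1 hr hs x hx hx'

/-- The two equations of a smooth complete intersection generate the ideal of forms vanishing
on it. -/
theorem IsTransverse.mem_span_pair (hn : 2 ≤ n) {f h F : MvPolynomial (Fin (n + 1)) ℂ} {a b N : ℕ}
    (hfh : IsTransverse f h) (hf : f.IsHomogeneous a) (ha : 1 ≤ a) (hh : h.IsHomogeneous b)
    (hb : 1 ≤ b) (hF : F.IsHomogeneous N)
    (hv : ∀ x : Fin (n + 1) → ℂ, x ≠ 0 → eval x f = 0 → eval x h = 0 → eval x F = 0) :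
    F ∈ Ideal.span {f, h} := by
  obtain ⟨hf0, hh0, hrel⟩ := hfh.isRelPrime hn hf ha hh hb
  have hF0 : eval 0 F = 0 := by
    rcases Nat.eq_zero_or_pos N with rfl | hN
    · obtain ⟨x, hx, hxf, hxh⟩ := exists_common_zero hn hf ha hh hb
      have := hv x hx hxf hxh
      rw [hF.eq_C, eval_C] at this ⊢
      exact this
    · exact hF.eval_zero (by omega)
  have hrad : F ∈ (Ideal.span {f, h}).radical := by
    rw [← vanishingIdeal_zeroLocus_eq_radical (K := ℂ)]
    intro x hx
    by_cases hx0 : x = 0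
    · simpa [hx0] using hF0
    · simpa using hv x hx0 (by simpa using hx f (Ideal.subset_span (by simp)))
        (by simpa using hx h (Ideal.subset_span (by simp)))
  -- The colon ideal `(f, h) : F`. Local reducedness shows that it has no zero away from the origin,
  -- so it contains a power of the irrelevant ideal, and saturation applies.
  let K : Ideal (MvPolynomial (Fin (n + 1)) ℂ) :=
    Submodule.comap (LinearMap.toSpanSingleton _ _ F) (Ideal.span {f, h})
  have hK : ∀ G, G ∈ K ↔ G * F ∈ Ideal.span {f, h} := fun G => Iff.rfl
  obtain ⟨M, hM⟩ := exists_pow_le_of_zeroLocus_subset (I := K) (by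
    intro x hx
    by_contra hx0
    have hle : ∀ g ∈ Ideal.span {f, h}, eval x g = 0 := fun g hg => by
      simpa using hx g ((hK g).mpr (Ideal.mul_mem_right _ _ hg))
    have hxf := hle f (Ideal.subset_span (by simp))
    have hxh := hle h (Ideal.subset_span (by simp))
    obtain ⟨s, hs, hsF⟩ := exists_eval_ne_zero_mul_mem_of_mem_radical hxf hxh
      (hfh x hx0 hxf hxh) hrad
    exact hs (by simpa using hx s ((hK s).mpr hsF)))
  exact mem_span_pair_of_pow_mul_mem hn hrel hh0 M F fun G hG => hM hG

/-- If `W = p f + q h`, singularity on the locus reads `p df + q dh = 0`, so independence of `df`,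
`dh` puts `p` and `q` in `(f, h)` as well. -/
theorem IsTransverse.exists_eq_of_singular (hn : 2 ≤ n) {f h W : MvPolynomial (Fin (n + 1)) ℂ}
    {a b N : ℕ} (hfh : IsTransverse f h) (hf : f.IsHomogeneous a) (ha : 1 ≤ a)
    (hh : h.IsHomogeneous b) (hb : 1 ≤ b) (hW : W.IsHomogeneous N)
    (hv : ∀ x : Fin (n + 1) → ℂ, x ≠ 0 → eval x f = 0 → eval x h = 0 →
      eval x W = 0 ∧ gradAt W x = 0) :
    ∃ α β₁ β₂ γ : MvPolynomial (Fin (n + 1)) ℂ, W = α * f ^ 2 + (β₁ + β₂) * f * h + γ * h ^ 2 ∧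
      α.IsHomogeneous (N - a - a) ∧ β₁.IsHomogeneous (N - a - b) ∧
      β₂.IsHomogeneous (N - b - a) ∧ γ.IsHomogeneous (N - b - b) := by
  obtain ⟨p, q, hpq, hp, -, hq, -⟩ := hW.exists_eq_of_mem_span_pair hf hh
    (hfh.mem_span_pair hn hf ha hh hb hW fun x hx h1 h2 => (hv x hx h1 h2).1)
  have hpq0 : ∀ x : Fin (n + 1) → ℂ, x ≠ 0 → eval x f = 0 → eval x h = 0 →
      eval x p = 0 ∧ eval x q = 0 := by
    intro x hx h1 h2
    have hind := LinearIndependent.pair_iff.mp (hfh x hx h1 h2) (eval x p) (eval x q)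
    apply hind
    rw [← (hv x hx h1 h2).2]
    ext i
    simp [gradAt, hpq, h1, h2]
  obtain ⟨α, β₁, e1, hα, -, hβ₁, -⟩ := hp.exists_eq_of_mem_span_pair hf hh
    (hfh.mem_span_pair hn hf ha hh hb hp fun x hx h1 h2 => (hpq0 x hx h1 h2).1)
  obtain ⟨β₂, γ, e2, hβ₂, -, hγ, -⟩ := hq.exists_eq_of_mem_span_pair hf hh
    (hfh.mem_span_pair hn hf ha hh hb hq fun x hx h1 h2 => (hpq0 x hx h1 h2).2)
  exact ⟨α, β₁, β₂, γ, by rw [hpq, e1, e2]; ring, hα, hβ₁, hβ₂, hγ⟩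

end Smooth

end MvPolynomial

/-! ### Consequences of the identity `w = a² - b h²`. -/

namespace MvPolynomial

variable {n : ℕ}

/-- The form `p` vanishes at the common zeros of `f` and `h`. -/
def VanishesOn (f h p : MvPolynomial (Fin (n + 1)) ℂ) : Prop :=
  ∀ x : Fin (n + 1) → ℂ, x ≠ 0 → eval x f = 0 → eval x h = 0 → eval x p = 0

/-- The properties of the forms `a`, `b`, `h` of degrees `k`, `2d`, `k - d` which make the
hypersurface `b = 0` everywhere tangent to the hypersurface `a² = b h²`. -/
structure IsTangentTriple (d k : ℕ) (a b h : MvPolynomial (Fin (n + 1)) ℂ) : Prop where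
  homA : a.IsHomogeneous k
  homB : b.IsHomogeneous (2 * d)
  homH : h.IsHomogeneous (k - d)
  a_ne : a ≠ 0
  h_ne : h ≠ 0
  smooth : ∀ x : Fin (n + 1) → ℂ, x ≠ 0 → eval x b = 0 → gradAt b x ≠ 0
  transverse : d < k → IsTransverse a h
  vanishesOn : d < k → ∀ (m : ℕ) (p : MvPolynomial (Fin (n + 1)) ℂ), p.IsHomogeneous m →
    VanishesOn a h (p * b) → VanishesOn a h p

/-- The ring is general because the universal form of the family has polynomial coefficients. If `2
* d < k` the truncated difference is `0`, which would let constants through; `hg0` excludes them. -/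
theorem isHomogeneous_translate {R σ : Type*} [CommRing R] {d k : ℕ} {a b g h : MvPolynomial σ R}
    (hk : d ≤ k) (ha : a.IsHomogeneous k) (hb : b.IsHomogeneous (2 * d))
    (hh : h.IsHomogeneous (k - d)) (hg : g.IsHomogeneous (2 * d - k)) (hg0 : 2 * d < k → g = 0) :
    (b + 2 * a * g + g ^ 2 * h ^ 2).IsHomogeneous (2 * d) := by
  by_cases h2 : 2 * d < k
  · simpa [hg0 h2] using hb
  · have h3 : (a * g).IsHomogeneous (2 * d) := by
      convert ha.mul hg using 1; omega
    have h4 : (g ^ 2 * h ^ 2).IsHomogeneous (2 * d) := by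
      convert (hg.pow 2).mul (hh.pow 2) using 1; omega
    rw [show 2 * a * g = a * g + a * g by ring]
    exact (hb.add (h3.add h3)).add h4

namespace IsTangentTriple

variable {d k : ℕ} {a b h : MvPolynomial (Fin (n + 1)) ℂ}

theorem irreducible (H : IsTangentTriple d k a b h) (hn : 2 ≤ n) (hd : 1 ≤ d) : Irreducible b :=
  irreducible_of_smooth hn H.homB (by omega) H.smooth

/-- `b` vanishes on no component of the locus, so `p` lies in `(a, h)`, whose generators have degree
at least `k - d`. -/
theorem eq_zero_of_vanishesOn_mul (H : IsTangentTriple d k a b h) (hn : 2 ≤ n)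
    (hdk : d < k) {m : ℕ} {p : MvPolynomial (Fin (n + 1)) ℂ} (hp : p.IsHomogeneous m)
    (hm : m < k - d) (hv : VanishesOn a h (p * b)) : p = 0 := by
  obtain ⟨u, v, huv, -, hu, -, hv'⟩ := hp.exists_eq_of_mem_span_pair H.homA H.homH
    ((H.transverse hdk).mem_span_pair hn H.homA (by omega) H.homH (by omega) hp
      (H.vanishesOn hdk m p hp hv))
  rw [huv, hu (by omega), hv' hm, zero_mul, zero_mul, add_zero]

theorem eq_zero_of_dvd (H : IsTangentTriple d k a b h) (hn : 2 ≤ n) (hd : 1 ≤ d) (hk : d ≤ k)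
    {p : MvPolynomial (Fin (n + 1)) ℂ} (hp : p.IsHomogeneous k) (hv : VanishesOn a h p)
    (hdvd : b ∣ p) : p = 0 := by
  obtain ⟨q, rfl, hq, hq0⟩ := hp.exists_eq_of_dvd H.homB hdvd
  by_cases hk2 : k < 2 * d
  · rw [hq0 hk2, zero_mul]
  · rw [H.eq_zero_of_vanishesOn_mul hn (by omega) hq (by omega) hv, zero_mul]

theorem not_dvd (H : IsTangentTriple d k a b h) (hn : 2 ≤ n) (hd : 1 ≤ d) (hk : d ≤ k) :
    ¬ b ∣ a := fun hdvd =>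
  H.a_ne (H.eq_zero_of_dvd hn hd hk H.homA (fun _ _ h1 _ => h1) hdvd)

theorem isRelPrime (H : IsTangentTriple d k a b h) (hn : 2 ≤ n) (hd : 1 ≤ d) (hk : d ≤ k) :
    IsRelPrime b (a ^ 2 - b * h ^ 2) := by
  have hirr := H.irreducible hn hd
  rw [hirr.isRelPrime_iff_not_dvd]
  intro hdvd
  have h1 : b ∣ a ^ 2 := by
    have := dvd_add hdvd (dvd_mul_right b (h ^ 2))
    rwa [sub_add_cancel] at this
  exact H.not_dvd hn hd hk (hirr.prime.dvd_of_dvd_pow h1)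

theorem gradAt_eq {x : Fin (n + 1) → ℂ} (hb : eval x b = 0)
    (hw : eval x (a ^ 2 - b * h ^ 2) = 0) :
    gradAt (a ^ 2 - b * h ^ 2) x = -(eval x h) ^ 2 • gradAt b x := by
  have ha : eval x a = 0 := by simpa [hb] using hw
  ext i
  simp only [gradAt, map_sub, Derivation.leibniz, Derivation.leibniz_pow, smul_eq_mul, map_add,
    map_mul, map_pow, hb, ha, Pi.smul_apply, nsmul_eq_mul, map_natCast]
  simp

theorem exists_eq_C_mul (H : IsTangentTriple d k a b h) (hn : 2 ≤ n) (hd : 1 ≤ d) (hk : d ≤ k)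
    {a' : MvPolynomial (Fin (n + 1)) ℂ} (ha' : a'.IsHomogeneous k) (hv : VanishesOn a h a')
    (hmem : a' ^ 2 ∈ Ideal.span {b, a ^ 2}) : ∃ c : ℂ, a' = C c * a := by
  obtain ⟨u, v, huv, -, -, hv0, -⟩ := (ha'.pow 2).exists_eq_of_mem_span_pair H.homB
    (H.homA.pow 2) hmem
  rw [Nat.sub_self] at hv0
  obtain ⟨r, hr⟩ := IsAlgClosed.exists_eq_mul_self (coeff 0 v)
  have hv1 : v = C r * C r := by rw [← C_mul, ← hr]; exact hv0.eq_C
  -- The coefficient of `a ^ 2` is a constant by degree; its square root `r` splits the difference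
  -- of squares, and the prime `b` divides a factor.
  have hprod : b ∣ (a' - C r * a) * (a' + C r * a) :=
    ⟨u, by linear_combination huv + a ^ 2 * hv1⟩
  have aux : ∀ s : ℂ, b ∣ a' - C s * a → a' = C s * a := fun s hs =>
    sub_eq_zero.mp (H.eq_zero_of_dvd hn hd hk (ha'.sub (H.homA.C_mul s))
      (fun x h0 h1 h2 => by simp [hv x h0 h1 h2, h1]) hs)
  rcases (H.irreducible hn hd).prime.dvd_or_dvd hprod with h1 | h1
  · exact ⟨r, aux r h1⟩
  · refine ⟨-r, aux (-r) ?_⟩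
    rwa [C_neg, neg_mul, sub_neg_eq_add]

/-- The other members of the family: `a` and `b` are replaced by `a + g h²` and
`b + 2 a g + g² h²`. -/
theorem translate (H : IsTangentTriple d k a b h) (hk : d ≤ k)
    {g : MvPolynomial (Fin (n + 1)) ℂ} (hg : g.IsHomogeneous (2 * d - k))
    (hg0 : 2 * d < k → g = 0) (ha : a + g * h ^ 2 ≠ 0)
    (hs : ∀ x : Fin (n + 1) → ℂ, x ≠ 0 → eval x (b + 2 * a * g + g ^ 2 * h ^ 2) = 0 →
      gradAt (b + 2 * a * g + g ^ 2 * h ^ 2) x ≠ 0) :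
    IsTangentTriple d k (a + g * h ^ 2) (b + 2 * a * g + g ^ 2 * h ^ 2) h := by
  have hA : (g * h ^ 2).IsHomogeneous k := by
    by_cases h2 : 2 * d < k
    · rw [hg0 h2, zero_mul]; exact isHomogeneous_zero _ _ _
    · convert hg.mul (H.homH.pow 2) using 1; omega
  have hZ : ∀ x : Fin (n + 1) → ℂ, eval x h = 0 → eval x (a + g * h ^ 2) = eval x a := by
    intro x hx
    simp [hx]
  refine ⟨H.homA.add hA, isHomogeneous_translate hk H.homA H.homB H.homH hg hg0, H.homH, ha, H.h_ne, hs, ?_, ?_⟩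
  · intro hdk x hx h1 h2
    rw [hZ x h2] at h1
    have := H.transverse hdk x hx h1 h2
    convert this using 2
    ext i
    simp [gradAt, h2]
  · intro hdk m p hp hv x hx h1 h2
    rw [hZ x h2] at h1
    refine H.vanishesOn hdk m p hp ?_ x hx h1 h2
    intro y hy h3 h4
    have := hv y hy (by rw [hZ y h4]; exact h3) h4
    simpa [h3, h4] using this

/-- The prime `b` divides `g (2 a + g h²)`, and each factor is too small to be a nonzero multiple of
it. The second alternative means that the translation replaces `a` by `-a`. -/
theorem eq_zero_or_of_proportional (H : IsTangentTriple d k a b h) (hn : 2 ≤ n) (hd : 1 ≤ d)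
    (hk : d ≤ k) {g : MvPolynomial (Fin (n + 1)) ℂ} (hg : g.IsHomogeneous (2 * d - k))
    (hg0 : 2 * d < k → g = 0) {e : ℂ} (he : b + 2 * a * g + g ^ 2 * h ^ 2 = C e * b) :
    g = 0 ∨ 2 * a + g * h ^ 2 = 0 := by
  have heq : C (e - 1) * b = g * (2 * a + g * h ^ 2) := by
    rw [C_sub, C_1]
    linear_combination -he
  have hA : (2 * a + g * h ^ 2).IsHomogeneous k := by
    have h1 := H.homA.C_mul 2
    rw [show (C 2 : MvPolynomial (Fin (n + 1)) ℂ) = 2 from map_ofNat C 2] at h1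
    refine h1.add ?_
    by_cases h2 : 2 * d < k
    · rw [hg0 h2, zero_mul]; exact isHomogeneous_zero _ _ _
    · convert hg.mul (H.homH.pow 2) using 1; omega
  rcases (H.irreducible hn hd).prime.dvd_or_dvd (Dvd.intro_left _ heq) with h1 | h1
  · left
    obtain ⟨q, hq, -, hq0⟩ := hg.exists_eq_of_dvd H.homB h1
    rw [hq, hq0 (by omega), zero_mul]
  · right
    exact H.eq_zero_of_dvd hn hd hk hA (fun x _ h2 h3 => by simp [h2, h3]) h1

end IsTangentTriple

end MvPolynomial

/-! ### From forms to hypersurfaces: tangency, contact locus and lift. -/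

namespace ProjHypersurface

variable {n e : ℕ}

theorem isHomogeneous_eqn (G : ProjHypersurface n e) : G.eqn.IsHomogeneous e :=
  (mem_homogeneousSubmodule _ _).mp (G.rep : homogeneousSubmodule (Fin (n + 1)) ℂ e).2

theorem exists_eqn_eq {P : MvPolynomial (Fin (n + 1)) ℂ} (hP : P.IsHomogeneous e) (h0 : P ≠ 0) :
    ∃ (G : ProjHypersurface n e) (c : ℂ), c ≠ 0 ∧ G.eqn = C c * P := by
  let p : homogeneousSubmodule (Fin (n + 1)) ℂ e := ⟨P, (mem_homogeneousSubmodule _ _).mpr hP⟩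
  have hp : p ≠ 0 := fun h => h0 (congrArg Subtype.val h)
  obtain ⟨c, hc⟩ := Projectivization.exists_smul_eq_mk_rep ℂ p hp
  refine ⟨Projectivization.mk ℂ p hp, c, c.ne_zero, ?_⟩
  rw [eqn, ← hc, ← smul_eq_C_mul]
  rfl

theorem eq_of_eqn_eq {G G' : ProjHypersurface n e} {c : ℂ} (h : G.eqn = C c * G'.eqn) :
    G = G' := by
  rw [← G.mk_rep, ← G'.mk_rep, Projectivization.mk_eq_mk_iff']
  exact ⟨c, Subtype.ext (by rw [← smul_eq_C_mul] at h; exact h.symm)⟩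

end ProjHypersurface

namespace MvPolynomial

variable {n : ℕ}

theorem vanishesOn_iff {f h p : MvPolynomial (Fin (n + 1)) ℂ} {i j l : ℕ} (hf : f.IsHomogeneous i)
    (hh : h.IsHomogeneous j) (hp : p.IsHomogeneous l) :
    VanishesOn f h p ↔
      ∀ x : ProjSpace n, eval x.rep f = 0 → eval x.rep h = 0 → eval x.rep p = 0 := by
  refine ⟨fun H x => H x.rep x.rep_nonzero, fun H v hv h1 h2 => ?_⟩
  obtain ⟨c, hc⟩ := Projectivization.exists_smul_eq_mk_rep ℂ v hv
  have hc' : (c : ℂ) • v = (Projectivization.mk ℂ v hv).rep := hc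
  have h3 := H (Projectivization.mk ℂ v hv)
  rw [← hc', hf.eval_smul, hh.eval_smul, hp.eval_smul, h1, h2] at h3
  simpa using h3

namespace IsTangentTriple

variable {d k : ℕ} {a b h : MvPolynomial (Fin (n + 1)) ℂ}

theorem mem_family (H : IsTangentTriple d k a b h) (hn : 2 ≤ n) (hd : 1 ≤ d) (hk : d ≤ k)
    {W : ProjHypersurface n (2 * k)} {B : ProjHypersurface n (2 * d)} {cW cB : ℂ}
    (hcW : cW ≠ 0) (hcB : cB ≠ 0) (hW : W.eqn = C cW * (a ^ 2 - b * h ^ 2))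
    (hB : B.eqn = C cB * b) :
    B.IsSmooth ∧ IsEverywhereTangent B W ∧
      (∃! A : ProjHypersurface n k,
        {x : ProjSpace n | eval x.rep a = 0 ∧ eval x.rep h = 0} ⊆ A.points ∧
          CutsOutContactLocus A B W) ∧
      LiftsToDoubleCover W {x : ProjSpace n | eval x.rep a = 0 ∧ eval x.rep h = 0} B := by
  have hC : ∀ {c : ℂ}, c ≠ 0 → (C c⁻¹ * C c : MvPolynomial (Fin (n + 1)) ℂ) = 1 := fun hc => by
    rw [← C_mul, inv_mul_cancel₀ hc, C_1]
  have hCu : ∀ {c : ℂ}, c ≠ 0 → IsUnit (C c : MvPolynomial (Fin (n + 1)) ℂ) := fun hc =>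
    (IsUnit.mk0 _ hc).map C
  have hgrad : ∀ (c : ℂ) (p : MvPolynomial (Fin (n + 1)) ℂ) (x : Fin (n + 1) → ℂ),
      gradAt (C c * p) x = c • gradAt p x := by
    intro c p x
    ext i
    simp [gradAt]
  refine ⟨?_, ⟨?_, ?_⟩, ?_, ?_⟩
  · intro x hx
    have hx' : eval x.rep B.eqn = 0 := hx
    rw [hB, map_mul, eval_C] at hx'
    rw [hB, hgrad]
    exact smul_ne_zero hcB
      (H.smooth _ x.rep_nonzero ((mul_eq_zero.mp hx').resolve_left hcB))
  · rw [hB, hW, isRelPrime_mul_unit_left_left (hCu hcB), isRelPrime_mul_unit_left_right (hCu hcW)]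
    exact H.isRelPrime hn hd hk
  · rintro x ⟨hxB, hxW⟩ v hv
    have hxB' : eval x.rep B.eqn = 0 := hxB
    have hxW' : eval x.rep W.eqn = 0 := hxW
    rw [hB, map_mul, eval_C] at hxB'
    rw [hW, map_mul, eval_C] at hxW'
    rw [hB, hgrad, smul_dotProduct, smul_eq_mul] at hv
    rw [hW, hgrad, gradAt_eq ((mul_eq_zero.mp hxB').resolve_left hcB)
      ((mul_eq_zero.mp hxW').resolve_left hcW), smul_dotProduct, smul_dotProduct,
      (mul_eq_zero.mp hv).resolve_left hcB, smul_zero, smul_zero]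
  · obtain ⟨A, cA, hcA, hA⟩ := ProjHypersurface.exists_eqn_eq H.homA H.a_ne
    refine ⟨A, ⟨?_, ?_⟩, ?_⟩
    · rintro x ⟨hx, -⟩
      change eval x.rep A.eqn = 0
      rw [hA, map_mul, hx, mul_zero]
    · have e1 := hC hcB
      have e2 := hC hcW
      have e3 := hC hcA
      apply le_antisymm
      · rw [Ideal.span_le]
        rintro P (rfl | rfl)
        · exact Ideal.subset_span (by simp)
        · refine Ideal.mem_span_pair.mpr ⟨-(C cW * C cB⁻¹ * h ^ 2), C cW * (C cA⁻¹) ^ 2, ?_⟩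
          rw [hB, hA, hW]
          linear_combination -(C cW * h ^ 2 * b) * e1 +
            C cW * a ^ 2 * (C cA⁻¹ * C cA + 1) * e3
      · rw [Ideal.span_le]
        rintro P (rfl | rfl)
        · exact Ideal.subset_span (by simp)
        · refine Ideal.mem_span_pair.mpr
            ⟨C cA ^ 2 * C cB⁻¹ * h ^ 2, C cA ^ 2 * C cW⁻¹, ?_⟩
          rw [hB, hA, hW]
          linear_combination (C cA ^ 2 * h ^ 2 * b) * e1 +
            C cA ^ 2 * (a ^ 2 - b * h ^ 2) * e2
    · rintro A' ⟨hZ, hcut⟩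
      have hmem : A'.eqn ^ 2 ∈ Ideal.span {b, a ^ 2} := by
        have h1 : A'.eqn ^ 2 ∈ Ideal.span {B.eqn, W.eqn} := by
          rw [hcut]; exact Ideal.subset_span (by simp)
        obtain ⟨u, v, huv⟩ := Ideal.mem_span_pair.mp h1
        refine Ideal.mem_span_pair.mpr ⟨u * C cB - v * C cW * h ^ 2, v * C cW, ?_⟩
        rw [← huv, hB, hW]
        ring
      obtain ⟨c, hc⟩ := H.exists_eq_C_mul hn hd hk A'.isHomogeneous_eqn
        ((vanishesOn_iff H.homA H.homH A'.isHomogeneous_eqn).mpr fun x h1 h2 => hZ ⟨h1, h2⟩) hmem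
      apply ProjHypersurface.eq_of_eqn_eq (c := c * cA⁻¹)
      rw [hc, hA, C_mul]
      linear_combination -(C c * a) * hC hcA
  · obtain ⟨r, hr⟩ := IsAlgClosed.exists_eq_mul_self cB
    have hr0 : r ≠ 0 := by rintro rfl; exact hcB (by rw [hr, zero_mul])
    -- The chosen equation of `B` is `r ^ 2 * b`, so on the cover `y / r` is a square root of `b`;
    -- hence the section `a + y h / r`. Over a point of `W` off the locus `h` is nonzero, which
    -- determines `y`.
    refine ⟨a, C r⁻¹ * h, H.homA, H.homH.C_mul _, fun h1 => absurd hk (by omega),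
      ⟨_, rfl, cW, hcW, ?_⟩, ?_⟩
    · have hroot : (AdjoinRoot.root ((Polynomial.X : Polynomial (MvPolynomial (Fin (n + 1)) ℂ)) ^ 2
          - Polynomial.C B.eqn)) ^ 2 = doubleCoverPullback B B.eqn := by
        have h1 := AdjoinRoot.eval₂_root
          ((Polynomial.X : Polynomial (MvPolynomial (Fin (n + 1)) ℂ)) ^ 2 - Polynomial.C B.eqn)
        rw [Polynomial.eval₂_sub, Polynomial.eval₂_pow, Polynomial.eval₂_X, Polynomial.eval₂_C,
          sub_eq_zero] at h1
        exact h1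
      have hinv : ∀ p, coverInvolution B (doubleCoverPullback B p) = doubleCoverPullback B p :=
        fun p => AdjoinRoot.lift_of _
      have hinvr : coverInvolution B (AdjoinRoot.root _) = -AdjoinRoot.root _ :=
        AdjoinRoot.lift_root _
      rw [map_add (coverInvolution B), map_mul (coverInvolution B), hinv, hinv, hinvr]
      have e1 : doubleCoverPullback B W.eqn = doubleCoverPullback B (C cW) *
          (doubleCoverPullback B a ^ 2 -
            doubleCoverPullback B (b * h ^ 2)) := by
        rw [hW, map_mul, map_sub, map_pow]
      have e2 : b * h ^ 2 = B.eqn * (C r⁻¹ * h) ^ 2 := by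
        rw [hB, hr, C_mul]
        linear_combination -(b * h ^ 2 * (C r⁻¹ * C r + 1)) * hC hr0
      rw [e1, e2, map_mul _ B.eqn, map_pow, ← hroot]
      ring
    · rintro x ⟨hxW, hxZ⟩
      have hxW' : eval x.rep W.eqn = 0 := hxW
      rw [hW, map_mul, eval_C] at hxW'
      have hw := (mul_eq_zero.mp hxW').resolve_left hcW
      simp only [map_sub, map_mul, map_pow] at hw
      have hxh : eval x.rep h ≠ 0 := by
        intro h0
        rw [h0] at hw
        exact hxZ ⟨by simpa using hw, h0⟩
      refine ⟨-(r * eval x.rep a / eval x.rep h), ⟨?_, ?_⟩, ?_⟩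
      · rw [hB, map_mul, eval_C, hr]
        field_simp
        linear_combination hw
      · rw [map_mul, eval_C]
        field_simp
        ring
      · rintro y ⟨-, hy⟩
        rw [map_mul, eval_C] at hy
        field_simp at hy ⊢
        linear_combination hy

end IsTangentTriple

end MvPolynomial

/-! ### Openness of smoothness. -/

namespace MvPolynomial

variable {n : ℕ}

/-- The exponents of the monomials of degree `e`. -/
def degreeFinset (n e : ℕ) : Finset (Fin (n + 1) →₀ ℕ) := Finset.univ.finsuppAntidiag e

theorem mem_degreeFinset {e : ℕ} {μ : Fin (n + 1) →₀ ℕ} : μ ∈ degreeFinset n e ↔ μ.degree = e := by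
  simp [degreeFinset, Finset.mem_finsuppAntidiag, Finsupp.degree_eq_sum]

theorem IsHomogeneous.eq_sum {b : MvPolynomial (Fin (n + 1)) ℂ} {e : ℕ} (hb : b.IsHomogeneous e) :
    b = ∑ μ ∈ degreeFinset n e, coeff μ b • monomial μ 1 := by
  ext ν
  simp only [coeff_sum, coeff_smul, coeff_monomial, smul_eq_mul, mul_ite, mul_one, mul_zero,
    Finset.sum_ite_eq', mem_degreeFinset]
  split_ifs with h
  · rfl
  · exact hb.coeff_eq_zero h

/-- A linear functional on forms of degree `e`, as a linear form in the coefficients. -/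
def linForm (n e : ℕ) (ℓ : MvPolynomial (Fin (n + 1)) ℂ →ₗ[ℂ] ℂ) :
    MvPolynomial (Fin (n + 1) →₀ ℕ) ℂ :=
  ∑ μ ∈ degreeFinset n e, C (ℓ (monomial μ 1)) * X μ

theorem isHomogeneous_linForm (e : ℕ) (ℓ : MvPolynomial (Fin (n + 1)) ℂ →ₗ[ℂ] ℂ) :
    (linForm n e ℓ).IsHomogeneous 1 :=
  IsHomogeneous.sum _ _ _ fun μ _ => (isHomogeneous_X ℂ μ).C_mul _

theorem eval_linForm {e : ℕ} (ℓ : MvPolynomial (Fin (n + 1)) ℂ →ₗ[ℂ] ℂ)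
    {b : MvPolynomial (Fin (n + 1)) ℂ} (hb : b.IsHomogeneous e) :
    eval (fun μ => coeff μ b) (linForm n e ℓ) = ℓ b := by
  conv_rhs => rw [hb.eq_sum]
  simp [linForm, mul_comm]

theorem isHomogeneous_det {σ ι : Type*} [Fintype ι] [DecidableEq ι]
    (A : Matrix ι ι (MvPolynomial σ ℂ)) (hA : ∀ i j, (A i j).IsHomogeneous 1) :
    A.det.IsHomogeneous (Fintype.card ι) := by
  rw [Matrix.det_apply]
  refine IsHomogeneous.sum _ _ _ fun π _ => ?_
  have h : (∏ i, A (π i) i).IsHomogeneous (∑ _i : ι, 1) :=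
    IsHomogeneous.prod _ _ _ fun i _ => hA _ _
  rw [Finset.sum_const, smul_eq_mul, mul_one, Finset.card_univ] at h
  rcases Int.units_eq_one_or (Equiv.Perm.sign π) with hs | hs
  · rwa [hs, one_smul]
  · rw [hs, Units.neg_smul, one_smul]; exact h.neg

theorem IsHomogeneous.mem_pointIdeal_pow {p : MvPolynomial (Fin (n + 1)) ℂ} {M : ℕ}
    (hp : p.IsHomogeneous M) : p ∈ pointIdeal (0 : Fin (n + 1) → ℂ) ^ M := by
  rw [hp.eq_sum]
  refine Ideal.sum_mem _ fun μ hμ => ?_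
  rw [smul_eq_C_mul]
  apply Ideal.mul_mem_left
  rw [monomial_eq, C_1, one_mul, Finsupp.prod_fintype _ _ (fun i => pow_zero _)]
  rw [mem_degreeFinset, Finsupp.degree_eq_sum] at hμ
  rw [← hμ, ← Finset.prod_pow_eq_pow_sum]
  exact Ideal.prod_mem_prod fun i _ => Ideal.pow_mem_pow (by simp [RingHom.mem_ker]) _

/-- Smoothness of forms of degree `e` is an open condition: near a given smooth form, it is implied
by the non-vanishing of a homogeneous polynomial in the coefficients. -/
theorem exists_smooth_certificate {b₀ : MvPolynomial (Fin (n + 1)) ℂ} {e : ℕ}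
    (hb₀ : b₀.IsHomogeneous e) (he : 2 ≤ e)
    (hs : ∀ x : Fin (n + 1) → ℂ, x ≠ 0 → eval x b₀ = 0 → gradAt b₀ x ≠ 0) :
    ∃ (Δ : MvPolynomial (Fin (n + 1) →₀ ℕ) ℂ) (m : ℕ), Δ.IsHomogeneous m ∧
      eval (fun μ => coeff μ b₀) Δ ≠ 0 ∧
      ∀ b : MvPolynomial (Fin (n + 1)) ℂ, b.IsHomogeneous e → eval (fun μ => coeff μ b) Δ ≠ 0 →
        ∀ x : Fin (n + 1) → ℂ, x ≠ 0 → gradAt b x ≠ 0 := by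
  have heuler : ∀ x : Fin (n + 1) → ℂ, gradAt b₀ x = 0 → eval x b₀ = 0 := by
    intro x hx
    have h1 := congrArg (eval x) hb₀.sum_X_mul_pderiv
    rw [map_sum, Finset.sum_eq_zero] at h1
    · rw [nsmul_eq_mul, map_mul, map_natCast, eq_comm, mul_eq_zero] at h1
      exact h1.resolve_left (by exact_mod_cast (by omega : e ≠ 0))
    · intro i _
      rw [map_mul, show eval x (pderiv i b₀) = 0 from congrFun hx i, mul_zero]
  obtain ⟨M₀, hM₀⟩ := exists_pow_le_of_zeroLocus_subset
    (I := Ideal.span (Set.range fun i => pderiv i b₀)) (by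
      intro x hx
      by_contra hx0
      have hg : gradAt b₀ x = 0 := by
        ext i
        change eval x (pderiv i b₀) = 0
        simpa using hx (pderiv i b₀) (Ideal.subset_span ⟨i, rfl⟩)
      exact hs x hx0 (heuler x hg) hg)
  -- The partials of `b₀` have degree `e - 1`, so multipliers of degree `M₀` express all monomials
  -- of degree `M` through them.
  set M := M₀ + (e - 1) with hM
  have hρ : ∀ s : degreeFinset n M, ∃ ρ : Fin (n + 1) → MvPolynomial (Fin (n + 1)) ℂ,
      (∀ j, (ρ j).IsHomogeneous M₀) ∧ ∑ j, ρ j * pderiv j b₀ = monomial s.1 1 := by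
    intro s
    have hsM : (monomial s.1 (1 : ℂ)).IsHomogeneous M :=
      isHomogeneous_monomial _ (mem_degreeFinset.mp s.2)
    have hmem : (monomial s.1 1 : MvPolynomial (Fin (n + 1)) ℂ) ∈
        Ideal.span (Set.range fun i => pderiv i b₀) :=
      hM₀ (Ideal.pow_le_pow_right (by omega) hsM.mem_pointIdeal_pow)
    obtain ⟨u, hu⟩ := (Ideal.mem_span_range_iff_exists_fun).mp hmem
    refine ⟨fun j => homogeneousComponent M₀ (u j),
      fun j => homogeneousComponent_isHomogeneous _ _, ?_⟩
    simp only [← homogeneousComponent_mul_of_isHomogeneous hb₀.pderiv]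
    rw [← map_sum, hu, homogeneousComponent_of_mem hsM, if_pos rfl]
  choose ρ hρ1 hρ2 using hρ
  let T : MvPolynomial (Fin (n + 1)) ℂ → degreeFinset n M → MvPolynomial (Fin (n + 1)) ℂ :=
    fun b s => ∑ j, ρ s j * pderiv j b
  let ℓ : degreeFinset n M → degreeFinset n M → MvPolynomial (Fin (n + 1)) ℂ →ₗ[ℂ] ℂ :=
    fun s t => (lcoeff ℂ s.1) ∘ₗ
      ∑ j, (LinearMap.mulLeft ℂ (ρ t j)) ∘ₗ (pderiv j).toLinearMap
  have hℓ : ∀ s t b, ℓ s t b = coeff s.1 (T b t) := by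
    intro s t b
    simp [ℓ, T, coeff_sum]
  -- The multipliers `ρ` are kept fixed while `b₀` is replaced by a variable form `b`. The matrix is
  -- linear in `b` and is the identity at `b₀`; when it is invertible, the powers `X i ^ M` lie in
  -- the Jacobian ideal of `b`.
  let A : Matrix (degreeFinset n M) (degreeFinset n M) (MvPolynomial (Fin (n + 1) →₀ ℕ) ℂ) :=
    Matrix.of fun s t => linForm n e (ℓ s t)
  have hA : ∀ b : MvPolynomial (Fin (n + 1)) ℂ, b.IsHomogeneous e →
      eval (fun μ => coeff μ b) A.det = (Matrix.of fun s t => coeff s.1 (T b t)).det := by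
    intro b hb
    rw [RingHom.map_det]
    congr 1
    ext s t
    simp [A, eval_linForm _ hb, hℓ]
  refine ⟨A.det, _, isHomogeneous_det A fun s t => isHomogeneous_linForm _ _, ?_, ?_⟩
  · rw [hA b₀ hb₀]
    have : (Matrix.of fun s t : degreeFinset n M => coeff s.1 (T b₀ t)) = 1 := by
      ext s t
      simp only [Matrix.of_apply, T, hρ2, coeff_monomial, Matrix.one_apply, Subtype.ext_iff]
      simp [eq_comm]
    rw [this, Matrix.det_one]
    exact one_ne_zero
  · intro b hb hdet x hx hg
    rw [hA b hb] at hdet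
    apply hx
    ext i
    have hs0 : Finsupp.single i M ∈ degreeFinset n M := by
      rw [mem_degreeFinset, Finsupp.degree_single]
    obtain ⟨c, hc⟩ := (Matrix.mulVec_surjective_iff_isUnit.mpr
      ((Matrix.isUnit_iff_isUnit_det _).mpr (isUnit_iff_ne_zero.mpr hdet)))
        (Pi.single ⟨_, hs0⟩ 1)
    have hsum : ∑ t, c t • T b t = monomial (Finsupp.single i M) 1 := by
      have hh : (∑ t, c t • T b t).IsHomogeneous M := by
        refine IsHomogeneous.sum _ _ _ fun t _ => ?_
        rw [smul_eq_C_mul]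
        exact (IsHomogeneous.sum _ _ _ fun j _ => (hρ1 t j).mul hb.pderiv).C_mul _
      ext ν
      by_cases hν : ν.degree = M
      · have := congrFun hc ⟨ν, mem_degreeFinset.mpr hν⟩
        rw [Matrix.mulVec, dotProduct] at this
        simp only [coeff_sum, coeff_smul, smul_eq_mul, coeff_monomial]
        simp only [Matrix.of_apply, Pi.single_apply, Subtype.mk.injEq] at this
        rw [show (if Finsupp.single i M = ν then (1 : ℂ) else 0) =
          if ν = Finsupp.single i M then 1 else 0 by simp [eq_comm], ← this]
        exact Finset.sum_congr rfl fun t _ => mul_comm _ _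
      · rw [hh.coeff_eq_zero hν, coeff_monomial, if_neg]
        rintro rfl
        exact hν (Finsupp.degree_single _ _)
    have hev := congrArg (eval x) hsum
    rw [map_sum, Finset.sum_eq_zero] at hev
    · have hp : (Finsupp.single i M).prod (fun j e => x j ^ e) = x i ^ M :=
        Finsupp.prod_single_index (pow_zero _)
      rw [eval_monomial, one_mul, hp] at hev
      exact eq_zero_of_pow_eq_zero hev.symm
    · intro t _
      rw [smul_eval, map_sum, Finset.sum_eq_zero, mul_zero]
      intro j _
      rw [map_mul, show eval x (pderiv j b) = 0 from congrFun hg j, mul_zero]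

/-- The Fermat form. -/
def fermat (n e : ℕ) : MvPolynomial (Fin (n + 1)) ℂ := ∑ i, X i ^ e

theorem isHomogeneous_fermat (e : ℕ) : (fermat n e).IsHomogeneous e :=
  IsHomogeneous.sum _ _ _ fun i _ => isHomogeneous_X_pow i e

theorem gradAt_fermat_ne_zero {e : ℕ} (he : 2 ≤ e) {x : Fin (n + 1) → ℂ} (hx : x ≠ 0) :
    gradAt (fermat n e) x ≠ 0 := by
  intro h
  apply hx
  ext i
  have h1 := congrFun h i
  simp only [gradAt, fermat, map_sum, pderiv_pow, pderiv_X] at h1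
  rw [Finset.sum_eq_single i] at h1
  · simp only [Pi.single_eq_same, mul_one, map_mul, map_natCast, map_pow, eval_X, Pi.zero_apply,
      mul_eq_zero, Nat.cast_eq_zero] at h1
    exact eq_zero_of_pow_eq_zero (h1.resolve_left (by omega))
  · intro j _ hj
    simp [hj.symm]
  · simp

end MvPolynomial

/-! ### The algebraic family of tangent hypersurfaces. -/

namespace MvPolynomial

variable {n : ℕ}

theorem exists_linearIndependent_forms (n : ℕ) (e : ℤ) :
    ∃ γ : Fin (hZero n e) → MvPolynomial (Fin (n + 1)) ℂ, (∀ j, (γ j).IsHomogeneous e.toNat) ∧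
      LinearIndependent ℂ γ := by
  by_cases he : 0 ≤ e
  · rw [hZero, if_pos he]
    obtain ⟨γ, hγ⟩ := exists_linearIndependent_of_le_finrank
      (R := ℂ) (M := homogeneousSubmodule (Fin (n + 1)) ℂ e.toNat) le_rfl
    exact ⟨fun j => γ j, fun j => (mem_homogeneousSubmodule _ _).mp (γ j).2,
      hγ.map' (homogeneousSubmodule (Fin (n + 1)) ℂ e.toNat).subtype (Submodule.ker_subtype _)⟩
  · rw [hZero, if_neg he]
    exact ⟨Fin.elim0, fun j => j.elim0, linearIndependent_empty_type⟩

theorem vanishingIdeal_compl_zeroLocus {r : ℕ} {q : MvPolynomial (Fin r) ℂ} (hq : q ≠ 0) :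
    vanishingIdeal ℂ (zeroLocus ℂ (⊥ : Ideal (MvPolynomial (Fin r) ℂ)) \
      zeroLocus ℂ (Ideal.span {q})) = ⊥ := by
  rw [eq_bot_iff]
  intro p hp
  have h1 : p * q = 0 := by
    apply MvPolynomial.funext
    intro t
    rw [map_mul, map_zero]
    by_cases ht : eval t q = 0
    · rw [ht, mul_zero]
    · have : eval t p = 0 := by
        have := hp t ⟨by simp, fun h => ht (by
          simpa using h q (Ideal.mem_span_singleton_self q))⟩
        simpa using this
      rw [this, zero_mul]
  exact (mul_eq_zero.mp h1).resolve_right hq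

namespace IsTangentTriple

variable {d k : ℕ} {a b h : MvPolynomial (Fin (n + 1)) ℂ}

set_option maxHeartbeats 1000000 in
theorem containsFamilyOfDim (H : IsTangentTriple d k a b h) (hn : 2 ≤ n) (hd : 1 ≤ d) (hk : d ≤ k)
    {W : ProjHypersurface n (2 * k)} {cW : ℂ} (hcW : cW ≠ 0)
    (hW : W.eqn = C cW * (a ^ 2 - b * h ^ 2)) :
    ContainsFamilyOfDim
      {B : ProjHypersurface n (2 * d) | B.IsSmooth ∧ IsEverywhereTangent B W ∧
        (∃! A : ProjHypersurface n k,
          {x : ProjSpace n | eval x.rep a = 0 ∧ eval x.rep h = 0} ⊆ A.points ∧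
            CutsOutContactLocus A B W) ∧
        LiftsToDoubleCover W {x : ProjSpace n | eval x.rep a = 0 ∧ eval x.rep h = 0} B}
      (hZero n (2 * (d : ℤ) - (k : ℤ))) := by
  -- `N` becomes a free variable so that `0` can be substituted for it when `2 * d < k`; the family
  -- is then a single point.
  obtain ⟨N, hN', γ, hγ, hind⟩ : ∃ N, N = hZero n (2 * (d : ℤ) - (k : ℤ)) ∧
      ∃ γ : Fin N → MvPolynomial (Fin (n + 1)) ℂ,
        (∀ j, (γ j).IsHomogeneous (2 * (d : ℤ) - (k : ℤ)).toNat) ∧ LinearIndependent ℂ γ :=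
    ⟨_, rfl, exists_linearIndependent_forms n (2 * (d : ℤ) - (k : ℤ))⟩
  have hN : 2 * d < k → N = 0 := fun h => by
    rw [hN', hZero, if_neg (by omega)]
  rw [← hN']
  rw [show (2 * (d : ℤ) - (k : ℤ)).toNat = 2 * d - k by omega] at hγ
  let g : (Fin N → ℂ) → MvPolynomial (Fin (n + 1)) ℂ := fun t => ∑ j, C (t j) * γ j
  have hg : ∀ t, (g t).IsHomogeneous (2 * d - k) := fun t =>
    IsHomogeneous.sum _ _ _ fun j _ => (hγ j).C_mul _
  have hg0 : 2 * d < k → ∀ t, g t = 0 := by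
    intro h2 t
    obtain rfl := hN h2
    simp [g]
  have hginj : Function.Injective g := by
    intro s t hst
    have h1 : ∑ j, (s j - t j) • γ j = 0 := by
      have h2 : g s - g t = 0 := sub_eq_zero.mpr hst
      simpa [g, ← Finset.sum_sub_distrib, smul_eq_C_mul, sub_mul] using h2
    ext j
    exact sub_eq_zero.mp (Fintype.linearIndependent_iff.mp hind _ h1 j)
  let G : MvPolynomial (Fin (n + 1)) (MvPolynomial (Fin N) ℂ) := ∑ j, C (X j) * map C (γ j)
  let F : MvPolynomial (Fin (n + 1)) (MvPolynomial (Fin N) ℂ) :=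
    map C b + 2 * map C a * G + G ^ 2 * map C h ^ 2
  have hmapC : ∀ (t : Fin N → ℂ) (p : MvPolynomial (Fin (n + 1)) ℂ),
      map (eval t) (map C p) = p := by
    intro t p
    rw [map_map, show (eval t).comp C = RingHom.id ℂ by ext; simp, map_id]
  have hGt : ∀ t, map (eval t) G = g t := by
    intro t
    simp [G, g, hmapC]
  let Bt : (Fin N → ℂ) → MvPolynomial (Fin (n + 1)) ℂ := fun t =>
    b + 2 * a * g t + g t ^ 2 * h ^ 2
  have hFt : ∀ t, map (eval t) F = Bt t := by
    intro t
    simp [F, Bt, hmapC, hGt]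
  have hBt : ∀ t, (Bt t).IsHomogeneous (2 * d) := fun t =>
    isHomogeneous_translate hk H.homA H.homB H.homH (hg t) fun h2 => hg0 h2 t
  have hF : F.IsHomogeneous (2 * d) := by
    refine isHomogeneous_translate hk (H.homA.map C) (H.homB.map C) (H.homH.map C) ?_ ?_
    · exact IsHomogeneous.sum _ _ _ fun j _ => ((hγ j).map C).C_mul _
    · intro h2
      obtain rfl := hN h2
      simp [G]
  obtain ⟨Δ, -, -, hΔ0, hΔ⟩ := exists_smooth_certificate H.homB (by omega) H.smooth
  obtain ⟨y, hy⟩ : ∃ y, eval y a ≠ 0 := by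
    by_contra! h0
    exact H.a_ne (MvPolynomial.funext fun x => by rw [h0 x, map_zero])
  -- The parameter space is `q₁ q₂ ≠ 0` in affine space: `q₁` ensures smoothness, `q₂` that `a + g
  -- h²` is nonzero at `y`. The origin belongs to it.
  let q₁ : MvPolynomial (Fin N) ℂ := aeval (fun μ => coeff μ F) Δ
  let q₂ : MvPolynomial (Fin N) ℂ := C (eval y a) + (∑ j, X j * C (eval y (γ j))) * C (eval y h) ^ 2
  have hq₁ : ∀ t, eval t q₁ = eval (fun μ => coeff μ (Bt t)) Δ := by
    intro t
    simp only [q₁]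
    rw [aeval_def, eval₂_comp_left, ← hFt]
    simp only [coeff_map]
    rw [show (eval t).comp (algebraMap ℂ (MvPolynomial (Fin N) ℂ)) = RingHom.id ℂ by
      ext; simp]
    rfl
  have hq₂ : ∀ t, eval t q₂ = eval y (a + g t * h ^ 2) := by
    intro t
    simp [q₂, g]
  have hg00 : g 0 = 0 := by simp [g]
  have hq : q₁ * q₂ ≠ 0 := by
    intro h0
    have h1 := congrArg (eval 0) h0
    rw [map_mul, hq₁, hq₂, map_zero, show Bt 0 = b by simp [Bt, hg00], hg00, zero_mul, add_zero,
      mul_eq_zero] at h1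
    exact h1.elim hΔ0 hy
  have htriple : ∀ t, eval t (q₁ * q₂) ≠ 0 → IsTangentTriple d k (a + g t * h ^ 2) (Bt t) h := by
    intro t ht
    rw [map_mul, hq₁, hq₂, mul_ne_zero_iff] at ht
    refine H.translate hk (hg t) (fun h2 => hg0 h2 t) ?_ ?_
    · intro h0
      exact ht.2 (by rw [h0, map_zero])
    · exact fun x hx _ => hΔ _ (hBt t) ht.1 x hx
  have hmemT : ∀ t, t ∈ zeroLocus ℂ (⊥ : Ideal (MvPolynomial (Fin N) ℂ)) \
      zeroLocus ℂ (Ideal.span {q₁ * q₂}) → eval t (q₁ * q₂) ≠ 0 := by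
    rintro t ⟨-, ht⟩ h0
    apply ht
    rw [zeroLocus_span]
    rintro p rfl
    simpa using h0
  refine ⟨N, zeroLocus ℂ (⊥ : Ideal (MvPolynomial (Fin N) ℂ)) \ zeroLocus ℂ (Ideal.span {q₁ * q₂}),
    F, ⟨⊥, _, rfl⟩, ?_, ?_, hF, ?_, ?_⟩
  · rw [vanishingIdeal_compl_zeroLocus hq]
    exact Ideal.isPrime_bot
  · rw [vanishingIdeal_compl_zeroLocus hq,
      ringKrullDim_eq_of_ringEquiv (RingEquiv.quotientBot (MvPolynomial (Fin N) ℂ)),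
      MvPolynomial.ringKrullDim_of_isNoetherianRing, ringKrullDim_eq_zero_of_field, zero_add,
      Nat.card_eq_fintype_card, Fintype.card_fin]
  · intro t ht
    have Ht := htriple t (hmemT t ht)
    obtain ⟨B, cB, hcB, hB⟩ := ProjHypersurface.exists_eqn_eq (hBt t) (Ht.irreducible hn hd).ne_zero
    refine ⟨B, ?_, cB⁻¹, inv_ne_zero hcB, ?_⟩
    · have hZ : {x : ProjSpace n | eval x.rep a = 0 ∧ eval x.rep h = 0} =
          {x : ProjSpace n | eval x.rep (a + g t * h ^ 2) = 0 ∧ eval x.rep h = 0} := by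
        ext x
        refine and_congr_left fun hx => ?_
        simp [hx]
      rw [hZ]
      refine Ht.mem_family hn hd hk hcW hcB ?_ hB
      rw [hW]
      simp only [Bt]
      ring
    · rw [hFt, hB, ← smul_eq_C_mul, smul_smul, inv_mul_cancel₀ hcB, one_smul]
  · intro B
    by_cases hne : ∃ t₀, t₀ ∈ zeroLocus ℂ (⊥ : Ideal (MvPolynomial (Fin N) ℂ)) \
        zeroLocus ℂ (Ideal.span {q₁ * q₂}) ∧ ∃ c : ℂ, c ≠ 0 ∧ map (eval t₀) F = c • B.eqn
    swap
    · convert Set.finite_empty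
      ext t
      simp only [Set.mem_ofPred_eq, Set.mem_empty_iff_false, iff_false]
      exact fun ht => hne ⟨t, ht⟩
    obtain ⟨t₀, ht₀, c₀, hc₀, he₀⟩ := hne
    have H₀ := htriple t₀ (hmemT t₀ ht₀)
    -- Relative to `t₀`, the triple at `t` is the translate by `g t - g t₀`. Proportionality leaves
    -- `t = t₀` or this equation, which has at most one solution since `h ≠ 0`.
    have hsub : {t | 2 * (a + g t₀ * h ^ 2) + (g t - g t₀) * h ^ 2 = 0}.Subsingleton := by
      intro s hs t ht
      apply hginj
      have h1 : (g s - g t) * h ^ 2 = 0 := by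
        have hs' : 2 * (a + g t₀ * h ^ 2) + (g s - g t₀) * h ^ 2 = 0 := hs
        have ht' : 2 * (a + g t₀ * h ^ 2) + (g t - g t₀) * h ^ 2 = 0 := ht
        linear_combination hs' - ht'
      exact sub_eq_zero.mp ((mul_eq_zero.mp h1).resolve_right (pow_ne_zero 2 H.h_ne))
    refine ((Set.finite_singleton t₀).union hsub.finite).subset ?_
    rintro t ⟨-, c, hc, he⟩
    rw [hFt] at he he₀
    have hprop : Bt t₀ + 2 * (a + g t₀ * h ^ 2) * (g t - g t₀) + (g t - g t₀) ^ 2 * h ^ 2 =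
        C (c * c₀⁻¹) * Bt t₀ := by
      have h1 : Bt t = C (c * c₀⁻¹) * Bt t₀ := by
        rw [he, he₀, ← smul_eq_C_mul, smul_smul, inv_mul_cancel_right₀ hc₀]
      rw [← h1]
      simp only [Bt]
      ring
    rcases H₀.eq_zero_or_of_proportional hn hd hk ((hg t).sub (hg t₀))
      (fun h2 => by rw [hg0 h2, hg0 h2, sub_zero]) hprop with h1 | h1
    · exact Or.inl (hginj (sub_eq_zero.mp h1))
    · exact Or.inr h1

end IsTangentTriple

end MvPolynomial

/-- The triple `(α, β, γ)` need not be determined by `w`, but it must be chosen linearly in `w` and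
pass through a prescribed good triple. A rank-one correction with values in the kernel of `Λ`
arranges this. -/
theorem LinearMap.exists_section_of_ne_zero {K V U : Type*} [Field K] [AddCommGroup V] [Module K V]
    [AddCommGroup U] [Module K U] (Λ : V →ₗ[K] U) {v₀ : V} (h : Λ v₀ ≠ 0) :
    ∃ σ : U →ₗ[K] V, (∀ v, Λ (σ (Λ v)) = Λ v) ∧ σ (Λ v₀) = v₀ := by
  obtain ⟨s, hs⟩ := Λ.rangeRestrict.exists_rightInverse_of_surjective Λ.range_rangeRestrict
  obtain ⟨σ, hσ⟩ := s.exists_extend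
  have hσ' : ∀ v, Λ (σ (Λ v)) = Λ v := by
    intro v
    have h1 : σ (Λ v) = s (Λ.rangeRestrict v) := (DFunLike.congr_fun hσ (Λ.rangeRestrict v))
    rw [h1]
    exact congrArg Subtype.val (DFunLike.congr_fun hs (Λ.rangeRestrict v))
  obtain ⟨φ, hφ⟩ : ∃ φ : Module.Dual K U, φ (Λ v₀) ≠ 0 := by
    by_contra! H
    exact h ((Module.forall_dual_apply_eq_zero_iff K _).mp H)
  refine ⟨σ + (((φ (Λ v₀))⁻¹ • φ).smulRight (v₀ - σ (Λ v₀))), fun v => ?_, ?_⟩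
  · simp [hσ']
  · simp [hφ]

/-! ### The discriminant along `Z` and ordinary double points. -/

namespace MvPolynomial

variable {n : ℕ}

theorem mem_radical_of_vanishesOn {f h q : MvPolynomial (Fin (n + 1)) ℂ}
    (hq : VanishesOn f h q) (h0 : eval 0 q = 0) : q ∈ (Ideal.span {f, h}).radical := by
  rw [← vanishingIdeal_zeroLocus_eq_radical (K := ℂ)]
  intro x hx
  by_cases hx0 : x = 0
  · simpa [hx0] using h0
  · simpa using hq x hx0 (by simpa using hx f (Ideal.subset_span (by simp)))
      (by simpa using hx h (Ideal.subset_span (by simp)))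

theorem vanishesOn_of_mem_radical {f h q : MvPolynomial (Fin (n + 1)) ℂ}
    (hq : q ∈ (Ideal.span {f, h}).radical) : VanishesOn f h q := by
  intro x _ h1 h2
  rw [← vanishingIdeal_zeroLocus_eq_radical (K := ℂ)] at hq
  have := hq x (by
    rw [zeroLocus_span]
    rintro p (rfl | rfl)
    · simpa using h1
    · simpa using h2)
  simpa using this

theorem homogeneousComponent_mem_radical {f h q : MvPolynomial (Fin (n + 1)) ℂ} {a b : ℕ}
    (hf : f.IsHomogeneous a) (hh : h.IsHomogeneous b) (hq : q ∈ (Ideal.span {f, h}).radical)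
    (m : ℕ) : homogeneousComponent m q ∈ (Ideal.span {f, h}).radical := by
  let _ : GradedAlgebra (homogeneousSubmodule (Fin (n + 1)) ℂ) := gradedAlgebra
  refine homogeneousComponent_mem_of_mem (Ideal.IsHomogeneous.radical ?_) hq m
  apply Ideal.homogeneous_span
  rintro x (rfl | rfl)
  · exact ⟨a, hf⟩
  · exact ⟨b, hh⟩

/-- If `δ` vanishes on no component of the locus `f = h = 0`, this can be tested at finitely many
points. -/
theorem exists_test_points {f h δ : MvPolynomial (Fin (n + 1)) ℂ} {a b e : ℕ}
    (hf : f.IsHomogeneous a) (hh : h.IsHomogeneous b) (hδ : δ.IsHomogeneous e) (he : 1 ≤ e)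
    (hnz : ∀ (m : ℕ) (q : MvPolynomial (Fin (n + 1)) ℂ), q.IsHomogeneous m →
      VanishesOn f h (q * δ) → VanishesOn f h q) :
    ∃ V : Finset (Fin (n + 1) → ℂ), (∀ v ∈ V, eval v δ ≠ 0) ∧
      ∀ δ' : MvPolynomial (Fin (n + 1)) ℂ, δ'.IsHomogeneous e → (∀ v ∈ V, eval v δ' ≠ 0) →
        ∀ (m : ℕ) (q : MvPolynomial (Fin (n + 1)) ℂ), q.IsHomogeneous m →
          VanishesOn f h (q * δ') → VanishesOn f h q := by
  classical
  by_cases hZ : ∃ x : Fin (n + 1) → ℂ, x ≠ 0 ∧ eval x f = 0 ∧ eval x h = 0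
  swap
  · exact ⟨∅, by simp, fun _ _ _ _ _ _ _ x hx h1 h2 => absurd ⟨x, hx, h1, h2⟩ hZ⟩
  obtain ⟨z, hz, hzf, hzh⟩ := hZ
  set I := Ideal.span {f, h} with hI
  have hfin : I.minimalPrimes.Finite := Ideal.finite_minimalPrimes_of_isNoetherianRing _ I
  -- An element of a minimal prime of a radical ideal is a zero divisor modulo that ideal; a
  -- homogeneous component of the cofactor would contradict `hnz`. The Nullstellensatz then provides
  -- one test point for each minimal prime.
  have hnot : ∀ 𝔭 ∈ I.minimalPrimes, δ ∉ 𝔭 := by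
    intro 𝔭 h𝔭 hmem
    rw [← Ideal.radical_minimalPrimes] at h𝔭
    obtain ⟨q, hq, hδq⟩ := Ideal.exists_mul_mem_of_mem_minimalPrimes h𝔭 hmem
    apply hq
    rw [← sum_homogeneousComponent q]
    refine Ideal.sum_mem _ fun m _ => ?_
    have h1 := homogeneousComponent_mem_radical hf hh hδq (m + e)
    rw [mul_comm, homogeneousComponent_mul_of_isHomogeneous hδ] at h1
    have hqm := homogeneousComponent_isHomogeneous m q
    have h2 := hnz m _ hqm (vanishesOn_of_mem_radical h1)
    apply mem_radical_of_vanishesOn h2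
    rcases Nat.eq_zero_or_pos m with rfl | hm
    · have h3 := h2 z hz hzf hzh
      rw [hqm.eq_C, eval_C] at h3 ⊢
      exact h3
    · exact hqm.eval_zero (by omega)
  have hpt : ∀ 𝔭 ∈ I.minimalPrimes, ∃ v ∈ zeroLocus ℂ 𝔭, eval v δ ≠ 0 := by
    intro 𝔭 h𝔭
    have hp : 𝔭.IsPrime := h𝔭.1.1
    by_contra! H
    apply hnot 𝔭 h𝔭
    rw [← hp.radical, ← vanishingIdeal_zeroLocus_eq_radical (K := ℂ)]
    intro v hv
    simpa using H v hv
  choose! v hv hvδ using hpt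
  refine ⟨hfin.toFinset.image v, ?_, ?_⟩
  · intro x hx
    obtain ⟨𝔭, h𝔭, rfl⟩ := Finset.mem_image.mp hx
    exact hvδ 𝔭 (hfin.mem_toFinset.mp h𝔭)
  · intro δ' hδ' hV m q hq hvan
    have hrad : q * δ' ∈ I.radical := mem_radical_of_vanishesOn hvan (by
      rw [map_mul, hδ'.eval_zero (by omega), mul_zero])
    apply vanishesOn_of_mem_radical
    rw [← Ideal.sInf_minimalPrimes]
    refine Ideal.mem_sInf.mpr fun {𝔭} h𝔭 => ?_
    have hp : 𝔭.IsPrime := h𝔭.1.1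
    have h3 : q * δ' ∈ 𝔭 := hp.radical_le_iff.mpr h𝔭.1.2 hrad
    refine (hp.mem_or_mem h3).resolve_right fun h4 => ?_
    exact hV (v 𝔭) (Finset.mem_image_of_mem _ (hfin.mem_toFinset.mpr h𝔭))
      (by simpa using hv 𝔭 h𝔭 δ' h4)

/-- The coefficients of the quadratic forms in `f` and `h`. -/
abbrev QuadCoeffs (n d : ℕ) : Type :=
  ℂ × homogeneousSubmodule (Fin (n + 1)) ℂ d × homogeneousSubmodule (Fin (n + 1)) ℂ (2 * d)

/-- The form `α f² + β f h + γ h²`. -/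
def quadForm (d : ℕ) (f h : MvPolynomial (Fin (n + 1)) ℂ) :
    QuadCoeffs n d →ₗ[ℂ] MvPolynomial (Fin (n + 1)) ℂ where
  toFun p := C p.1 * f ^ 2 + p.2.1.1 * f * h + p.2.2.1 * h ^ 2
  map_add' p q := by
    simp only [Prod.fst_add, Prod.snd_add, Submodule.coe_add, C_add]
    ring
  map_smul' c p := by
    simp only [Prod.smul_fst, Prod.smul_snd, Submodule.coe_smul, smul_eq_mul, C_mul,
      RingHom.id_apply, smul_eq_C_mul]
    ring

theorem quadForm_apply (d : ℕ) (f h : MvPolynomial (Fin (n + 1)) ℂ) (p : QuadCoeffs n d) :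
    quadForm d f h p = C p.1 * f ^ 2 + p.2.1.1 * f * h + p.2.2.1 * h ^ 2 := rfl

/-- The discriminant `β² - 4 α γ`. -/
def quadDisc {d : ℕ} (p : QuadCoeffs n d) : MvPolynomial (Fin (n + 1)) ℂ :=
  p.2.1.1 ^ 2 - C (4 * p.1) * p.2.2.1

theorem isHomogeneous_quadDisc {d : ℕ} (p : QuadCoeffs n d) :
    (quadDisc p).IsHomogeneous (2 * d) := by
  have h1 : p.2.1.1.IsHomogeneous d := p.2.1.2
  have h2 : p.2.2.1.IsHomogeneous (2 * d) := p.2.2.2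
  have h3 := h1.pow 2
  rw [mul_comm d 2] at h3
  exact h3.sub (h2.C_mul _)

theorem isHomogeneous_quadForm {d k : ℕ} (hk : d ≤ k) {f h : MvPolynomial (Fin (n + 1)) ℂ}
    (hf : f.IsHomogeneous k) (hh : h.IsHomogeneous (k - d)) (p : QuadCoeffs n d) :
    (quadForm d f h p).IsHomogeneous (2 * k) := by
  have h1 : p.2.1.1.IsHomogeneous d := p.2.1.2
  have h2 : p.2.2.1.IsHomogeneous (2 * d) := p.2.2.2
  rw [quadForm_apply]
  refine (IsHomogeneous.add ?_ ?_).add ?_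
  · convert (hf.pow 2).C_mul p.1 using 1; omega
  · convert (h1.mul hf).mul hh using 1; omega
  · convert h2.mul (hh.pow 2) using 1; omega

theorem gradAt_quadForm {d : ℕ} {f h : MvPolynomial (Fin (n + 1)) ℂ} (p : QuadCoeffs n d)
    {x : Fin (n + 1) → ℂ} (hf : eval x f = 0) (hh : eval x h = 0) :
    eval x (quadForm d f h p) = 0 ∧ gradAt (quadForm d f h p) x = 0 := by
  refine ⟨by simp [quadForm_apply, hf, hh], ?_⟩
  ext i
  simp [gradAt, quadForm_apply, hf, hh]

theorem hessianAt_quadForm {d : ℕ} {f h : MvPolynomial (Fin (n + 1)) ℂ} (p : QuadCoeffs n d)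
    {x : Fin (n + 1) → ℂ} (hf : eval x f = 0) (hh : eval x h = 0) (i j : Fin (n + 1)) :
    hessianAt (quadForm d f h p) x i j =
      2 * p.1 * (gradAt f x i * gradAt f x j) +
        eval x p.2.1.1 *
          (gradAt f x i * gradAt h x j + gradAt f x j * gradAt h x i) +
        2 * eval x p.2.2.1 * (gradAt h x i * gradAt h x j) := by
  simp only [hessianAt, gradAt, quadForm_apply, Matrix.of_apply, map_add, Derivation.leibniz,
    Derivation.leibniz_pow, smul_eq_mul, nsmul_eq_mul, map_mul, map_pow, hf, hh, pderiv_C,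
    map_natCast, Derivation.map_natCast, map_zero, eval_C]
  simp
  ring

/-- The tangent cone is `α u² + β u v + γ v²` in the independent linear forms `u = df`, `v = dh`.
With zero discriminant it is a multiple of a square; otherwise a 2 × 2 minor of the Hessian equals
minus the discriminant times a squared nonzero minor of `u`, `v`. -/
theorem rank_hessianAt_quadForm {d : ℕ} {f h : MvPolynomial (Fin (n + 1)) ℂ} (p : QuadCoeffs n d)
    {x : Fin (n + 1) → ℂ} (hf : eval x f = 0) (hh : eval x h = 0)
    (hind : LinearIndependent ℂ ![gradAt f x, gradAt h x]) :
    (hessianAt (quadForm d f h p) x).rank = 2 ↔ eval x (quadDisc p) ≠ 0 := by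
  set u := gradAt f x with hu
  set v := gradAt h x with hv
  set β := eval x p.2.1.1 with hβ
  set γ := eval x p.2.2.1 with hγ
  have hH := hessianAt_quadForm p hf hh
  rw [← hu, ← hv, ← hβ, ← hγ] at hH
  have hdisc : eval x (quadDisc p) = β ^ 2 - 4 * p.1 * γ := by
    simp [quadDisc, hβ, hγ]
  rw [hdisc]
  constructor
  · intro hr h0
    have hle : (hessianAt (quadForm d f h p) x).rank ≤ 1 := by
      by_cases hα : p.1 = 0
      · have hβ0 : β = 0 := by
          rw [hα] at h0
          simpa using h0
        have : hessianAt (quadForm d f h p) x = Matrix.vecMulVec ((2 * γ) • v) v := by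
          ext i j
          rw [hH, hα, hβ0, Matrix.vecMulVec_apply, Pi.smul_apply, smul_eq_mul]
          ring
        rw [this]
        exact Matrix.rank_vecMulVec_le _ _
      · have : hessianAt (quadForm d f h p) x =
            Matrix.vecMulVec ((2 * p.1)⁻¹ • ((2 * p.1) • u + β • v)) ((2 * p.1) • u + β • v) := by
          ext i j
          rw [hH, Matrix.vecMulVec_apply]
          simp only [Pi.smul_apply, Pi.add_apply, smul_eq_mul]
          field_simp
          linear_combination -(v i * v j) * h0
        rw [this]
        exact Matrix.rank_vecMulVec_le _ _
    omega
  · intro hD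
    obtain ⟨i, j, hij⟩ := exists_minor_ne_zero hind
    apply le_antisymm
    · have : hessianAt (quadForm d f h p) x =
          Matrix.of (fun i => ![2 * p.1 * u i + β * v i, β * u i + 2 * γ * v i]) *
            Matrix.of ![u, v] := by
        ext i j
        rw [hH, Matrix.mul_apply, Fin.sum_univ_two]
        simp only [Matrix.of_apply, Matrix.cons_val_zero, Matrix.cons_val_one]
        ring
      rw [this]
      exact (Matrix.rank_mul_le_left _ _).trans (Matrix.rank_le_width _)
    · have hle := Matrix.rank_submatrix_le (hessianAt (quadForm d f h p) x) ![i, j] ![i, j]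
      have hdet : ((hessianAt (quadForm d f h p) x).submatrix ![i, j] ![i, j]).det ≠ 0 := by
        rw [Matrix.det_fin_two]
        simp only [Matrix.submatrix_apply, Matrix.cons_val_zero, Matrix.cons_val_one, hH]
        have h1 := mul_ne_zero (pow_ne_zero 2 hij) hD
        intro h2
        apply h1
        linear_combination -h2
      rw [Matrix.rank_of_isUnit _ ((Matrix.isUnit_iff_isUnit_det _).mpr
        (isUnit_iff_ne_zero.mpr hdet)), Fintype.card_fin] at hle
      exact hle

/-- Singularity along `Z` is automatic for a quadratic form in `f`, `h`, so only the discriminant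
matters: its non-vanishing locus must be dense in `Z`. -/
theorem hasOrdinaryDouble_iff {d k e : ℕ} {f h : MvPolynomial (Fin (n + 1)) ℂ}
    (hf : f.IsHomogeneous k) (hh : h.IsHomogeneous e) (hT : IsTransverse f h)
    {W : ProjHypersurface n (2 * k)} {p : QuadCoeffs n d} (hW : W.eqn = quadForm d f h p) :
    HasOrdinaryDoubleSingularityAlong W {x | eval x.rep f = 0 ∧ eval x.rep h = 0} ↔
      ∀ (m : ℕ) (q : MvPolynomial (Fin (n + 1)) ℂ), q.IsHomogeneous m →
        VanishesOn f h (q * quadDisc p) → VanishesOn f h q := by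
  have hsing : ∀ x ∈ {x : ProjSpace n | eval x.rep f = 0 ∧ eval x.rep h = 0}, IsSingularAt W x := by
    rintro x ⟨h1, h2⟩
    have h3 := gradAt_quadForm p h1 h2
    rw [← hW] at h3
    exact ⟨h3.1, h3.2⟩
  have hord : ∀ x ∈ {x : ProjSpace n | eval x.rep f = 0 ∧ eval x.rep h = 0},
      (IsOrdinaryDoubleAt W x ↔ eval x.rep (quadDisc p) ≠ 0) := by
    rintro x ⟨h1, h2⟩
    rw [IsOrdinaryDoubleAt, hW, rank_hessianAt_quadForm p h1 h2 (hT _ x.rep_nonzero h1 h2)]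
    exact and_iff_right (hsing x ⟨h1, h2⟩)
  rw [HasOrdinaryDoubleSingularityAlong, and_iff_right hsing]
  refine forall_congr' fun m => forall_congr' fun q => forall_congr' fun hq => ?_
  rw [vanishesOn_iff hf hh hq, vanishesOn_iff hf hh (hq.mul (isHomogeneous_quadDisc p))]
  constructor
  · intro H hv
    by_contra! hne
    obtain ⟨x, h1, h2, h3⟩ := hne
    obtain ⟨y, hy, hy', hy''⟩ := H ⟨x, ⟨h1, h2⟩, h3⟩
    have := hv y hy.1 hy.2
    rw [map_mul] at this
    exact mul_ne_zero hy' ((hord y hy).mp hy'') this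
  · rintro H ⟨x, hx, hx'⟩
    by_contra! hne
    refine hx' (H (fun y h1 h2 => ?_) x hx.1 hx.2)
    rw [map_mul]
    by_contra h3
    exact hne y ⟨h1, h2⟩ (left_ne_zero_of_mul h3)
      ((hord y ⟨h1, h2⟩).mpr (right_ne_zero_of_mul h3))

theorem exists_quadForm_eq (hn : 2 ≤ n) {d k : ℕ} (hd : 1 ≤ d) (hk : d ≤ k)
    {f h w : MvPolynomial (Fin (n + 1)) ℂ} (hf : f.IsHomogeneous k) (hh : h.IsHomogeneous (k - d))
    (h0 : h ≠ 0) (hT : IsTransverse f h) (hw : w.IsHomogeneous (2 * k))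
    (hv : ∀ x : Fin (n + 1) → ℂ, x ≠ 0 → eval x f = 0 → eval x h = 0 →
      eval x w = 0 ∧ gradAt w x = 0) :
    ∃ p : QuadCoeffs n d, w = quadForm d f h p := by
  rcases hk.eq_or_lt with rfl | hdk
  · rw [Nat.sub_self] at hh
    obtain ⟨c, rfl⟩ : ∃ c, h = C c := ⟨_, hh.eq_C⟩
    have hc : c ≠ 0 := fun e => h0 (by rw [e, C_0])
    refine ⟨(0, 0, ⟨C (c⁻¹) ^ 2 * w, ?_⟩), ?_⟩
    · rw [← C_pow]
      exact hw.C_mul _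
    · have h1 : (C c⁻¹ * C c : MvPolynomial (Fin (n + 1)) ℂ) = 1 := by
        rw [← C_mul, inv_mul_cancel₀ hc, C_1]
      simp only [quadForm_apply, C_0, Submodule.coe_zero]
      linear_combination -(w * (C c⁻¹ * C c + 1)) * h1
  · obtain ⟨α, β₁, β₂, γ, e, hα, hβ₁, hβ₂, hγ⟩ :=
      hT.exists_eq_of_singular hn hf (by omega) hh (by omega) hw hv
    rw [show 2 * k - k - k = 0 by omega] at hα
    rw [show 2 * k - k - (k - d) = d by omega] at hβ₁
    rw [show 2 * k - (k - d) - k = d by omega] at hβ₂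
    rw [show 2 * k - (k - d) - (k - d) = 2 * d by omega] at hγ
    refine ⟨(coeff 0 α, ⟨β₁ + β₂, hβ₁.add hβ₂⟩, ⟨γ, hγ⟩), ?_⟩
    rw [quadForm_apply, ← hα.eq_C]
    exact e

end MvPolynomial

theorem gradAt_smul {n e : ℕ} {f : MvPolynomial (Fin (n + 1)) ℂ} (hf : f.IsHomogeneous e) (c : ℂ)
    (x : Fin (n + 1) → ℂ) : gradAt f (c • x) = c ^ (e - 1) • gradAt f x := by
  ext i
  exact hf.pderiv.eval_smul c x

theorem IsSmoothCompleteIntersection.exists_equations {n d k : ℕ} (hn : 2 ≤ n) (hd : 1 ≤ d)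
    (hk : d ≤ k) {Z : Set (ProjSpace n)} (hZ : IsSmoothCompleteIntersection n k (k - d) Z) :
    ∃ f h : MvPolynomial (Fin (n + 1)) ℂ, f.IsHomogeneous k ∧ h.IsHomogeneous (k - d) ∧
      f ≠ 0 ∧ h ≠ 0 ∧ Z = {x | eval x.rep f = 0 ∧ eval x.rep h = 0} ∧ IsTransverse f h := by
  obtain ⟨f, h, hf, hh, rfl, hind⟩ := hZ
  have hT : IsTransverse f h := by
    intro v hv h1 h2
    obtain ⟨c, hc⟩ := Projectivization.exists_smul_eq_mk_rep ℂ v hv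
    have hc' : (c : ℂ) • v = (Projectivization.mk ℂ v hv).rep := hc
    have h3 := hind (Projectivization.mk ℂ v hv) (by
      simp only [Set.mem_ofPred_eq, ← hc', hf.eval_smul, hh.eval_smul, h1, h2, mul_zero, and_self])
    rw [← hc', gradAt_smul hf, gradAt_smul hh, LinearIndependent.pair_iff] at h3
    rw [LinearIndependent.pair_iff]
    intro s t hst
    have h4 := h3 (s * ((c : ℂ) ^ (k - 1))⁻¹) (t * ((c : ℂ) ^ (k - d - 1))⁻¹) (by
      rw [smul_smul, smul_smul, inv_mul_cancel_right₀ (pow_ne_zero _ c.ne_zero),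
        inv_mul_cancel_right₀ (pow_ne_zero _ c.ne_zero), hst])
    simpa using h4
  rcases hk.eq_or_lt with rfl | hdk
  · rw [Nat.sub_self] at hh ⊢
    have h0 : h ≠ 0 := by
      rintro rfl
      obtain ⟨x, hx, hx'⟩ := exists_ne_zero_eval_eq_zero (n := n) (by omega) hf hd
      exact (hT x hx hx' (map_zero _)).ne_zero 1 (by ext i; simp [gradAt])
    have hne : ∀ x, eval x h ≠ 0 := by
      intro x
      rw [hh.eq_C] at h0 ⊢
      rw [eval_C]
      exact fun e => h0 (by rw [e, C_0])
    -- Here `h` is a nonzero constant and `Z` is empty. The given `f` might be zero, so it is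
    -- replaced by a nonzero form of the same degree.
    refine ⟨X 0 ^ d, h, isHomogeneous_X_pow _ _, hh, pow_ne_zero _ (X_ne_zero _), h0, ?_,
      fun x _ _ h2 => absurd h2 (hne x)⟩
    ext x
    simp [hne]
  · obtain ⟨hf0, hh0, -⟩ := hT.isRelPrime hn hf (by omega) hh (by omega)
    exact ⟨f, h, hf, hh, hf0, hh0, rfl, hT⟩

/-! ### Completing the square for the general member. -/

namespace MvPolynomial

variable {n d k : ℕ} {f h : MvPolynomial (Fin (n + 1)) ℂ}

/-- Completing the square in a quadratic form in `f` and `h`. -/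
theorem exists_isTangentTriple (hk : d ≤ k) (hf : f.IsHomogeneous k)
    (hh : h.IsHomogeneous (k - d)) (h0 : h ≠ 0) (hT : IsTransverse f h) {p : QuadCoeffs n d}
    (hα : p.1 ≠ 0) (hne : C (2 * p.1) * f + p.2.1.1 * h ≠ 0)
    (hs : ∀ x : Fin (n + 1) → ℂ, x ≠ 0 → gradAt (quadDisc p) x ≠ 0)
    (hv : ∀ (m : ℕ) (q : MvPolynomial (Fin (n + 1)) ℂ), q.IsHomogeneous m →
      VanishesOn f h (q * quadDisc p) → VanishesOn f h q) :
    ∃ a b, IsTangentTriple d k a b h ∧ quadForm d f h p = a ^ 2 - b * h ^ 2 ∧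
      ∀ x, eval x h = 0 → (eval x a = 0 ↔ eval x f = 0) := by
  obtain ⟨r, hr⟩ := IsAlgClosed.exists_eq_mul_self p.1
  have hr0 : r ≠ 0 := by rintro rfl; exact hα (by rw [hr, zero_mul])
  have hβ : p.2.1.1.IsHomogeneous d := p.2.1.2
  have hZ : ∀ x, eval x h = 0 →
      (eval x (C (2 * r)⁻¹ * (C (2 * p.1) * f + p.2.1.1 * h)) = 0 ↔ eval x f = 0) := by
    intro x hx
    simp [hx, hα, hr0]
  have hvan : ∀ q, VanishesOn (C (2 * r)⁻¹ * (C (2 * p.1) * f + p.2.1.1 * h)) h q ↔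
      VanishesOn f h q := fun q =>
    ⟨fun H x hx h1 h2 => H x hx ((hZ x h2).mpr h1) h2,
      fun H x hx h1 h2 => H x hx ((hZ x h2).mp h1) h2⟩
  have hgrad : ∀ x, gradAt (C (4 * p.1)⁻¹ * quadDisc p) x = (4 * p.1)⁻¹ • gradAt (quadDisc p) x := by
    intro x
    ext i
    simp [gradAt]
  have hC : ∀ {c : ℂ}, c ≠ 0 → (C c⁻¹ * C c : MvPolynomial (Fin (n + 1)) ℂ) = 1 := fun hc => by
    rw [← C_mul, inv_mul_cancel₀ hc, C_1]
  -- With `r ^ 2 = α`: `a = (2 α f + β h) / (2 r)` and `b = (β² - 4 α γ) / (4 α)`.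
  refine ⟨C (2 * r)⁻¹ * (C (2 * p.1) * f + p.2.1.1 * h), C (4 * p.1)⁻¹ * quadDisc p,
    ⟨?_, (isHomogeneous_quadDisc p).C_mul _, hh, ?_, h0, ?_, ?_, ?_⟩, ?_, hZ⟩
  · refine IsHomogeneous.C_mul ((hf.C_mul _).add ?_) _
    convert hβ.mul hh using 1; omega
  · exact mul_ne_zero (C_ne_zero.mpr (inv_ne_zero (mul_ne_zero two_ne_zero hr0))) hne
  · intro x hx _
    rw [hgrad]
    exact smul_ne_zero (inv_ne_zero (mul_ne_zero (by norm_num : (4 : ℂ) ≠ 0) hα)) (hs x hx)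
  · intro _ x hx h1 h2
    have h3 := LinearIndependent.pair_iff.mp (hT x hx ((hZ x h2).mp h1) h2)
    have h4 : eval x f = 0 := (hZ x h2).mp h1
    rw [LinearIndependent.pair_iff]
    intro s t hst
    have h5 := h3 (s * ((2 * r)⁻¹ * (2 * p.1))) (s * ((2 * r)⁻¹ * eval x p.2.1.1) + t) (by
      rw [← hst]
      ext i
      simp [gradAt, h2]
      ring)
    have hs0 : s = 0 := by
      simpa [hr0, hα] using h5.1
    refine ⟨hs0, ?_⟩
    simpa [hs0] using h5.2
  · intro _ m q hq hq'
    rw [hvan] at hq' ⊢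
    refine hv m q hq fun x hx h1 h2 => ?_
    have := hq' x hx h1 h2
    simp only [map_mul, eval_C] at this ⊢
    simpa [hα] using this
  · have e1 : (C (2 * r)⁻¹ : MvPolynomial (Fin (n + 1)) ℂ) ^ 2 = C (4 * p.1)⁻¹ := by
      rw [← C_pow, hr]
      congr 1
      field_simp
      norm_num
    have e2 := hC (mul_ne_zero (by norm_num : (4 : ℂ) ≠ 0) hα)
    rw [quadForm_apply, quadDisc, mul_pow, e1]
    have e3 : (C (4 * p.1) : MvPolynomial (Fin (n + 1)) ℂ) = 4 * C p.1 := by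
      rw [C_mul, map_ofNat]
    have e4 : (C (2 * p.1) : MvPolynomial (Fin (n + 1)) ℂ) = 2 * C p.1 := by
      rw [C_mul, map_ofNat]
    rw [e3] at e2 ⊢
    rw [e4]
    linear_combination -(C p.1 * f ^ 2 + p.2.1.1 * f * h + p.2.2.1 * h ^ 2) * e2

/-- Take `γ` to be plus or minus the Fermat form. The sign is free because `f² + γ h²` and `f² - γ
h²` cannot both vanish. -/
theorem exists_smooth_quadDisc (hd : 1 ≤ d) (hf0 : f ≠ 0) :
    ∃ p : QuadCoeffs n d, quadForm d f h p ≠ 0 ∧ p.1 = 1 ∧ p.2.1 = 0 ∧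
      ∀ x : Fin (n + 1) → ℂ, x ≠ 0 → gradAt (quadDisc p) x ≠ 0 := by
  have key : ∀ c : ℂ, c ≠ 0 → ∀ x : Fin (n + 1) → ℂ, x ≠ 0 →
      gradAt (quadDisc ((1, 0, ⟨C c * fermat n (2 * d), (isHomogeneous_fermat _).C_mul c⟩) :
        QuadCoeffs n d)) x ≠ 0 := by
    intro c hc x hx
    have : gradAt (quadDisc ((1, 0, ⟨C c * fermat n (2 * d), (isHomogeneous_fermat _).C_mul c⟩) :
        QuadCoeffs n d)) x = (-(4 * c)) • gradAt (fermat n (2 * d)) x := by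
      ext i
      simp [gradAt, quadDisc]
      ring
    rw [this]
    exact smul_ne_zero (neg_ne_zero.mpr (mul_ne_zero (by norm_num : (4 : ℂ) ≠ 0) hc))
      (gradAt_fermat_ne_zero (by omega) hx)
  by_cases h1 : quadForm d f h
      (1, 0, ⟨C 1 * fermat n (2 * d), (isHomogeneous_fermat _).C_mul 1⟩) = 0
  · refine ⟨(1, 0, ⟨C (-1) * fermat n (2 * d), (isHomogeneous_fermat _).C_mul _⟩), fun h2 => ?_,
      rfl, rfl, key _ (by norm_num)⟩
    rw [quadForm_apply] at h1 h2
    simp only [C_1, Submodule.coe_zero, C_neg] at h1 h2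
    have h3 : 2 * f ^ 2 = 0 := by linear_combination h1 + h2
    exact hf0 (by simpa using h3)
  · exact ⟨_, h1, rfl, rfl, key 1 one_ne_zero⟩

/-- Openness is required in the coefficients of `w`, not in the triple, so the conditions are pulled
back along a linear section `σ` of `quadForm`. `Φ` is the product of `α`, the value of `2 α f + β h`
at a point `y`, and the smoothness certificate of the discriminant. As `σ` passes through a triple
with smooth discriminant, `Φ` is not identically zero on the class. -/
theorem exists_general_certificate (hd : 1 ≤ d) (hk : d ≤ k) (hf : f.IsHomogeneous k)
    (hh : h.IsHomogeneous (k - d)) (hf0 : f ≠ 0) :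
    ∃ (Φ : MvPolynomial (Fin (n + 1) →₀ ℕ) ℂ) (m : ℕ), Φ.IsHomogeneous m ∧
      (∃ p, eval (fun μ => coeff μ (quadForm d f h p)) Φ ≠ 0) ∧
      ∀ p', eval (fun μ => coeff μ (quadForm d f h p')) Φ ≠ 0 → quadForm d f h p' ≠ 0 ∧
        ∃ p, quadForm d f h p = quadForm d f h p' ∧ p.1 ≠ 0 ∧
          C (2 * p.1) * f + p.2.1.1 * h ≠ 0 ∧
          ∀ x : Fin (n + 1) → ℂ, x ≠ 0 → gradAt (quadDisc p) x ≠ 0 := by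
  obtain ⟨p₁, hp₁, hp₁α, hp₁β, hp₁s⟩ := exists_smooth_quadDisc (n := n) (h := h) hd hf0
  obtain ⟨σ, hσ, hσ₁⟩ := (quadForm d f h).exists_section_of_ne_zero hp₁
  obtain ⟨Δ, m, hΔm, hΔ₁, hΔ⟩ := exists_smooth_certificate (isHomogeneous_quadDisc p₁) (by omega)
    fun x hx _ => hp₁s x hx
  obtain ⟨y, hy⟩ : ∃ y, eval y f ≠ 0 := by
    by_contra! H
    exact hf0 (MvPolynomial.funext fun x => by rw [H x, map_zero])
  let ℓα : MvPolynomial (Fin (n + 1)) ℂ →ₗ[ℂ] ℂ := LinearMap.fst ℂ _ _ ∘ₗ σ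
  let ℓβ : MvPolynomial (Fin (n + 1)) ℂ →ₗ[ℂ] MvPolynomial (Fin (n + 1)) ℂ :=
    Submodule.subtype _ ∘ₗ LinearMap.fst ℂ _ _ ∘ₗ LinearMap.snd ℂ _ _ ∘ₗ σ
  let ℓγ : MvPolynomial (Fin (n + 1)) ℂ →ₗ[ℂ] MvPolynomial (Fin (n + 1)) ℂ :=
    Submodule.subtype _ ∘ₗ LinearMap.snd ℂ _ _ ∘ₗ LinearMap.snd ℂ _ _ ∘ₗ σ
  let ℓy : MvPolynomial (Fin (n + 1)) ℂ →ₗ[ℂ] ℂ :=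
    (2 * eval y f) • ℓα + eval y h • ((aeval y).toLinearMap ∘ₗ ℓβ)
  have hℓy : ∀ w, ℓy w = eval y (C (2 * (σ w).1) * f + (σ w).2.1.1 * h) := by
    intro w
    simp only [ℓy, ℓα, ℓβ, LinearMap.add_apply, LinearMap.smul_apply, LinearMap.comp_apply,
      LinearMap.fst_apply, LinearMap.snd_apply, Submodule.subtype_apply, smul_eq_mul, map_add,
      map_mul, eval_C, AlgHom.toLinearMap_apply]
    rw [show aeval y (σ w).2.1.1 = eval y (σ w).2.1.1 from rfl]
    ring
  let D : (Fin (n + 1) →₀ ℕ) → MvPolynomial (Fin (n + 1) →₀ ℕ) ℂ := fun μ =>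
    (∑ x ∈ Finset.HasAntidiagonal.antidiagonal μ, linForm n (2 * k) (lcoeff ℂ x.1 ∘ₗ ℓβ) *
      linForm n (2 * k) (lcoeff ℂ x.2 ∘ₗ ℓβ)) -
    C 4 * (linForm n (2 * k) ℓα * linForm n (2 * k) (lcoeff ℂ μ ∘ₗ ℓγ))
  have hDhom : ∀ μ, (D μ).IsHomogeneous 2 := fun μ =>
    (IsHomogeneous.sum _ _ _ fun x _ => (isHomogeneous_linForm _ _).mul
      (isHomogeneous_linForm _ _)).sub
        (((isHomogeneous_linForm _ _).mul (isHomogeneous_linForm _ _)).C_mul _)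
  have hD : ∀ w : MvPolynomial (Fin (n + 1)) ℂ, w.IsHomogeneous (2 * k) → ∀ μ,
      eval (fun μ => coeff μ w) (D μ) = coeff μ (quadDisc (σ w)) := by
    intro w hw μ
    rw [quadDisc, coeff_sub, pow_two, coeff_mul, coeff_C_mul]
    simp only [D, map_sub, map_sum, map_mul, eval_linForm _ hw, eval_C]
    simp only [ℓα, ℓβ, ℓγ, LinearMap.comp_apply, LinearMap.fst_apply, LinearMap.snd_apply,
      Submodule.subtype_apply, lcoeff_apply]
    ring
  let Φ : MvPolynomial (Fin (n + 1) →₀ ℕ) ℂ :=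
    linForm n (2 * k) ℓα * linForm n (2 * k) ℓy * aeval D Δ
  have hΦ : ∀ w : MvPolynomial (Fin (n + 1)) ℂ, w.IsHomogeneous (2 * k) →
      eval (fun μ => coeff μ w) Φ = (σ w).1 * eval y (C (2 * (σ w).1) * f + (σ w).2.1.1 * h) *
        eval (fun μ => coeff μ (quadDisc (σ w))) Δ := by
    intro w hw
    have h1 : eval (fun μ => coeff μ w) (aeval D Δ) =
        eval (fun μ => coeff μ (quadDisc (σ w))) Δ := by
      rw [aeval_def, eval₂_comp_left]
      rw [show (eval fun μ => coeff μ w).comp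
        (algebraMap ℂ (MvPolynomial (Fin (n + 1) →₀ ℕ) ℂ)) = RingHom.id ℂ by ext; simp]
      rw [show (⇑(eval fun μ => coeff μ w) ∘ D) = fun μ => coeff μ (quadDisc (σ w)) from
        _root_.funext (hD w hw)]
      rfl
    simp only [Φ]
    rw [map_mul, map_mul, eval_linForm _ hw, eval_linForm _ hw, hℓy, h1]
    rfl
  have hhom := isHomogeneous_quadForm (d := d) hk hf hh
  refine ⟨Φ, _, ((isHomogeneous_linForm _ _).mul (isHomogeneous_linForm _ _)).mul
    (hΔm.aeval D hDhom), ⟨p₁, ?_⟩, ?_⟩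
  · rw [hΦ _ (hhom p₁), hσ₁]
    refine mul_ne_zero (mul_ne_zero ?_ ?_) hΔ₁
    · rw [hp₁α]; exact one_ne_zero
    · rw [hp₁α, hp₁β]
      simpa using hy
  · intro p' hp'
    rw [hΦ _ (hhom p'), mul_ne_zero_iff, mul_ne_zero_iff] at hp'
    obtain ⟨⟨h1, h2⟩, h3⟩ := hp'
    refine ⟨fun e => h1 ?_, σ (quadForm d f h p'), hσ p', h1, fun e => h2 ?_,
      hΔ _ (isHomogeneous_quadDisc _) h3⟩
    · rw [e, map_zero]; rfl
    · rw [e, map_zero]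

/-- A polynomial function restricted to the line through `w₀` with direction `w`. -/
theorem exists_eval_line {ι : Type*} (Φ : MvPolynomial ι ℂ) (w₀ w : ι → ℂ) :
    ∃ P : Polynomial ℂ, ∀ t : ℂ, P.eval t = eval (fun i => w₀ i + t * w i) Φ := by
  refine ⟨aeval (fun i => Polynomial.C (w₀ i) + Polynomial.X * Polynomial.C (w i)) Φ, fun t => ?_⟩
  rw [← Polynomial.coe_evalRingHom, aeval_def, eval₂_comp_left]
  rw [show (Polynomial.evalRingHom t).comp (algebraMap ℂ (Polynomial ℂ)) = RingHom.id ℂ by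
    ext; simp]
  change eval₂ (RingHom.id ℂ) _ Φ = eval₂ (RingHom.id ℂ) _ Φ
  congr 1
  ext i
  simp
  exact mul_comm _ _

end MvPolynomial

end

theorem mainTheorem2 (n d k : ℕ) (hn : 2 ≤ n) (hd : 1 ≤ d) (hk : d ≤ k)
    (Z : Set (ProjSpace n)) (hZ : IsSmoothCompleteIntersection n k (k - d) Z) :
    HoldsForGeneral {W : ProjHypersurface n (2 * k) | HasOrdinaryDoubleSingularityAlong W Z}
      fun W =>
        ContainsFamilyOfDim
          {B : ProjHypersurface n (2 * d) |
            B.IsSmooth ∧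
            IsEverywhereTangent B W ∧
            (∃! A : ProjHypersurface n k, Z ⊆ A.points ∧ CutsOutContactLocus A B W) ∧
            LiftsToDoubleCover W Z B}
          (hZero n (2 * (d : ℤ) - (k : ℤ))) := by
  obtain ⟨f, h, hf, hh, hf0, hh0, rfl, hT⟩ := hZ.exists_equations hn hd hk
  obtain ⟨Φ, m, hΦm, ⟨p₁, hp₁⟩, hΦ⟩ := exists_general_certificate (n := n) hd hk hf hh hf0
  have hrep : ∀ W : ProjHypersurface n (2 * k),
      HasOrdinaryDoubleSingularityAlong W {x | eval x.rep f = 0 ∧ eval x.rep h = 0} →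
        ∃ p, W.eqn = quadForm d f h p := by
    intro W hW
    refine exists_quadForm_eq hn hd hk hf hh hh0 hT W.isHomogeneous_eqn fun v hv h1 h2 => ?_
    obtain ⟨c, hc⟩ := Projectivization.exists_smul_eq_mk_rep ℂ v hv
    have hc' : (c : ℂ) • v = (Projectivization.mk ℂ v hv).rep := hc
    have h3 := hW.1 (Projectivization.mk ℂ v hv) (by
      simp only [Set.mem_ofPred_eq, ← hc', hf.eval_smul, hh.eval_smul, h1, h2, mul_zero, and_self])
    have h4 : eval (Projectivization.mk ℂ v hv).rep W.eqn = 0 := h3.1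
    have h5 := h3.2
    rw [← hc', W.isHomogeneous_eqn.eval_smul] at h4
    rw [← hc', gradAt_smul W.isHomogeneous_eqn] at h5
    simpa using And.intro h4 h5
  refine ⟨{G | ∃ Ψ ∈ ({Φ} : Set _), eval (fun μ => coeff μ G.eqn) Ψ ≠ 0},
    ⟨{Φ}, fun Ψ hΨ => ⟨m, by rw [Set.mem_singleton_iff.mp hΨ]; exact hΦm⟩, rfl⟩, ?_, ?_⟩
  · rintro U' ⟨S, hS, rfl⟩ ⟨G₀, hG₀, Ψ, hΨ, hΨ₀⟩
    obtain ⟨p₀, hp₀⟩ := hrep G₀ hG₀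
    rw [hp₀] at hΨ₀
    obtain ⟨mΨ, hmΨ⟩ := hS Ψ hΨ
    obtain ⟨V, hV₀, hV⟩ := exists_test_points hf hh (isHomogeneous_quadDisc p₀) (by omega)
      ((hasOrdinaryDouble_iff hf hh hT hp₀).mp hG₀)
    -- Each open condition is a nonzero polynomial in `t`: the one from `Φ` is nonzero at `t = 1`,
    -- those from `Ψ` and the test points at `t = 0`. Some `t` satisfies all of them.
    let p : ℂ → QuadCoeffs n d := fun t => p₀ + t • (p₁ - p₀)
    have hp0 : p 0 = p₀ := by simp [p]
    have hp1 : p 1 = p₁ := by simp [p]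
    have hcoeff : ∀ t, (fun μ => coeff μ (quadForm d f h (p t))) = fun μ =>
        coeff μ (quadForm d f h p₀) + t * coeff μ (quadForm d f h (p₁ - p₀)) := by
      intro t
      funext μ
      simp only [p, map_add, map_smul, coeff_add, coeff_smul, smul_eq_mul]
    obtain ⟨P₁, hP₁⟩ := exists_eval_line Φ (fun μ => coeff μ (quadForm d f h p₀))
      (fun μ => coeff μ (quadForm d f h (p₁ - p₀)))
    obtain ⟨P₂, hP₂⟩ := exists_eval_line Ψ (fun μ => coeff μ (quadForm d f h p₀))
      (fun μ => coeff μ (quadForm d f h (p₁ - p₀)))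
    simp only [← hcoeff] at hP₁ hP₂
    have hdisc : ∀ v : Fin (n + 1) → ℂ, ∃ P : Polynomial ℂ, ∀ t,
        P.eval t = eval v (quadDisc (p t)) := by
      intro v
      refine ⟨(Polynomial.C (eval v p₀.2.1.1) + Polynomial.X *
        Polynomial.C (eval v (p₁ - p₀).2.1.1)) ^ 2 - 4 * (Polynomial.C p₀.1 + Polynomial.X *
        Polynomial.C (p₁ - p₀).1) * (Polynomial.C (eval v p₀.2.2.1) + Polynomial.X *
        Polynomial.C (eval v (p₁ - p₀).2.2.1)), fun t => ?_⟩
      simp [quadDisc, p, smul_eval]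
    choose P₃ hP₃ using hdisc
    have hprod : P₁ * P₂ * ∏ v ∈ V, P₃ v ≠ 0 := by
      refine mul_ne_zero (mul_ne_zero ?_ ?_) (Finset.prod_ne_zero_iff.mpr fun v hv => ?_)
      · intro e
        exact hp₁ (by rw [← hp1, ← hP₁, e, Polynomial.eval_zero])
      · intro e
        exact hΨ₀ (by rw [← hp0, ← hP₂, e, Polynomial.eval_zero])
      · intro e
        exact hV₀ v hv (by rw [← hp0, ← hP₃, e, Polynomial.eval_zero])
    obtain ⟨t, ht⟩ : ∃ t, (P₁ * P₂ * ∏ v ∈ V, P₃ v).eval t ≠ 0 := by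
      by_contra! H
      exact hprod (Polynomial.funext fun t => by rw [H t, Polynomial.eval_zero])
    rw [Polynomial.eval_mul, Polynomial.eval_mul, Polynomial.eval_prod, mul_ne_zero_iff,
      mul_ne_zero_iff, Finset.prod_ne_zero_iff, hP₁, hP₂] at ht
    obtain ⟨⟨ht₁, ht₂⟩, ht₃⟩ := ht
    obtain ⟨G, c, hc, hG⟩ := ProjHypersurface.exists_eqn_eq
      (isHomogeneous_quadForm hk hf hh (p t)) (hΦ (p t) ht₁).1
    have hGp : G.eqn = quadForm d f h (c • p t) := by rw [hG, map_smul, smul_eq_C_mul]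
    -- The chosen equation of `G` is only a multiple of the form built; homogeneity makes the
    -- conditions insensitive to `c`.
    have hscale : ∀ {Θ : MvPolynomial (Fin (n + 1) →₀ ℕ) ℂ} {e : ℕ}, Θ.IsHomogeneous e →
        eval (fun μ => coeff μ (quadForm d f h (p t))) Θ ≠ 0 →
        eval (fun μ => coeff μ G.eqn) Θ ≠ 0 := by
      intro Θ e hΘ hne
      have h1 : (fun μ => coeff μ G.eqn) = c • fun μ => coeff μ (quadForm d f h (p t)) := by
        funext μ
        rw [hG, coeff_C_mul, Pi.smul_apply, smul_eq_mul]
      rw [h1, hΘ.eval_smul]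
      exact mul_ne_zero (pow_ne_zero _ hc) hne
    refine ⟨G, ⟨?_, Φ, rfl, hscale hΦm ht₁⟩, Ψ, hΨ, hscale hmΨ ht₂⟩
    refine (hasOrdinaryDouble_iff hf hh hT hGp).mpr (hV _ (isHomogeneous_quadDisc _) ?_)
    intro v hv
    have h1 := ht₃ v hv
    rw [hP₃] at h1
    have h2 : eval v (quadDisc (c • p t)) = c ^ 2 * eval v (quadDisc (p t)) := by
      simp only [quadDisc, Prod.smul_fst, Prod.smul_snd, Submodule.coe_smul, smul_eq_mul, map_sub,
        map_mul, map_pow, smul_eval, eval_C]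
      ring
    rw [h2]
    exact mul_ne_zero (pow_ne_zero _ hc) h1
  · rintro W ⟨hWS, Ψ, hΨ, hW⟩
    rw [Set.mem_singleton_iff.mp hΨ] at hW
    obtain ⟨p', hp'⟩ := hrep W hWS
    rw [hp'] at hW
    obtain ⟨-, p, hpp', hα, hne, hs⟩ := hΦ p' hW
    -- The triple `p'` is exchanged for the good triple `p` with the same form, and the ordinary
    -- double condition is then read on the discriminant of `p`.
    rw [← hpp'] at hp'
    obtain ⟨a, b, H, hab, hZab⟩ := exists_isTangentTriple hk hf hh hh0 hT hα hne hs
      ((hasOrdinaryDouble_iff hf hh hT hp').mp hWS)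
    have hZeq : {x : ProjSpace n | eval x.rep f = 0 ∧ eval x.rep h = 0} =
        {x : ProjSpace n | eval x.rep a = 0 ∧ eval x.rep h = 0} := by
      ext x
      exact and_congr_left fun hx => (hZab _ hx).symm
    rw [hZeq]
    exact H.containsFamilyOfDim hn hd hk one_ne_zero (by rw [hp', hab, C_1, one_mul])
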